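/- Let $\Lambda=\Lambda_1\times\mathbb Z\subset\mathbb R^2$ with $\Lambda_1\subset\mathbb R$, and suppose that $\Lambda$ is uniform, i.e. $\inf\{|p-q| : p,q\in\Lambda,\ p\ne q\}>0$. Suppose that there is a constant $C>0$ such that for all $x\in\mathbb R^2$ and all $R>1$ $$\left|\#(\Lambda\cap K(x,R))-R^2\right|\le CR,$$ where $K(x,R)$ is the (axis-parallel) square with center $x$ and sidelength $R$. Then $\tilde W(\Lambda)<+\infty$, where $\tilde W$ is the following renormalized energy with background density $m=1$. Let $\mathscr F_\Lambda$ be the set of vector fields $j\in L^2_{\rm loc}(\mathbb R^2\setminus\Lambda,\mathbb R^2)$, locally integrable on $\mathbb R^2$, that satisfy $-\operatorname{div} j=2\pi\left(\sum_{p\in\Lambda}\delta_p-1\right)$ in the sense of distributions in $\mathbb R^2$. Let $(\chi_R)_{R>1}$ be any family of smooth functions on $\mathbb R^2$ with $\chi_R\ge 0$, $\chi_R=1$ on $B_{R-1}$, $\chi_R=0$ outside $B_R$, and $\|\nabla\chi_R\|_\infty$ bounded independently of $R$, where $B_R$ is the ball of radius $R$ centered at $0$. For $j\in\mathscr F_\Lambda$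 put $$W(j,\chi_R)=\limsup_{\eta\to0^+}\left(\frac12\int_{\mathbb R^2\setminus\bigcup_{p\in\Lambda}B(p,\eta)}\chi_R|j|^2+\pi\log\eta\sum_{p\in\Lambda}\chi_R(p)\right),\qquad W(j)=\limsup_{R\to\infty}\frac{W(j,\chi_R)}{|B_R|},$$ and $\tilde W(\Lambda)=\inf_{j\in\mathscr F_\Lambda}W(j)$ (with $\inf\varnothing=+\infty$). The conclusion holds for every such family $(\chi_R)$. -/

import Mathlib

open scoped ENNReal Topology ContDiff
open MeasureTheory Filter

noncomputable section

namespace RenormalizedEnergy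

/-- The Euclidean plane. -/
abbrev Plane : Type := EuclideanSpace ℝ (Fin 2)

/-- A set of points of the plane is uniform if its distinct points are at distance at least some
fixed positive number. Such a set is closed and discrete, and its bounded parts are finite. -/
def IsUniform (Λ : Set Plane) : Prop :=
  ∃ δ : ℝ, 0 < δ ∧ ∀ p ∈ Λ, ∀ q ∈ Λ, p ≠ q → δ ≤ dist p q

/-- The product `Λ₁ × ℤ`, as a subset of the plane. -/
def prodInt (Λ₁ : Set ℝ) : Set Plane :=
  {x | x 0 ∈ Λ₁ ∧ ∃ n : ℤ, x 1 = n}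

/-- The square with center `x` and sidelength `R`, with sides parallel to the axes. -/
def square (x : Plane) (R : ℝ) : Set Plane :=
  {y | |y 0 - x 0| ≤ R / 2 ∧ |y 1 - x 1| ≤ R / 2}

/-- A family `χ R`, `R > 1`, of smooth cut-off functions, approximating the indicator functions of
the balls `B_R` centered at the origin, with a bound on the gradients that is independent of `R`. -/
structure IsCutoffFamily (χ : ℝ → Plane → ℝ) : Prop where
  smooth : ∀ R : ℝ, 1 < R → ContDiff ℝ ∞ (χ R)
  nonneg : ∀ R : ℝ, 1 < R → ∀ x, 0 ≤ χ R x
  gradient_le : ∃ C : ℝ, ∀ R : ℝ, 1 < R → ∀ x, ‖gradient (χ R) x‖ ≤ C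
  eq_one : ∀ R : ℝ, 1 < R → ∀ x ∈ Metric.ball (0 : Plane) (R - 1), χ R x = 1
  eq_zero : ∀ R : ℝ, 1 < R → ∀ x ∉ Metric.ball (0 : Plane) R, χ R x = 0

/-- `-div j = 2π (∑_{p ∈ Λ} δ_p - m)` in the sense of distributions in the plane. -/
def SolvesDivEquation (Λ : Set Plane) (m : ℝ) (j : Plane → Plane) : Prop :=
  ∀ φ : Plane → ℝ, ContDiff ℝ ∞ φ → HasCompactSupport φ →
    ∫ x, inner ℝ (j x) (gradient φ x) = 2 * Real.pi * ((∑ᶠ p ∈ Λ, φ p) - m * ∫ x, φ x)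

/-- The set `F_Λ` of the vector fields in `L²_loc(ℝ² \ Λ, ℝ²)` that satisfy
`-div j = 2π (∑_{p ∈ Λ} δ_p - m)` in the plane. Local integrability in the plane makes `j` a
distribution there, so that the equation makes sense across the points of `Λ`. -/
def fields (Λ : Set Plane) (m : ℝ) : Set (Plane → Plane) :=
  {j | LocallyIntegrable j volume ∧
    (∀ K : Set Plane, IsCompact K → K ⊆ Λᶜ → MemLp j 2 (volume.restrict K)) ∧
    SolvesDivEquation Λ m j}

/-- `W(j, χ)`, the upper limit as `η → 0⁺` of
`½ ∫_{ℝ² \ ⋃_{p ∈ Λ} B(p, η)} χ |j|² + π log η ∑_{p ∈ Λ} χ(p)`. -/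
def localEnergy (Λ : Set Plane) (j : Plane → Plane) (χ : Plane → ℝ) : EReal :=
  limsup (fun η : ℝ =>
    ((2⁻¹ * ∫⁻ x in (⋃ p ∈ Λ, Metric.ball p η)ᶜ, ENNReal.ofReal (χ x * ‖j x‖ ^ 2) : ℝ≥0∞) : EReal)
      + ((Real.pi * Real.log η * ∑ᶠ p ∈ Λ, χ p : ℝ) : EReal)) (𝓝[>] (0 : ℝ))

/-- `W(j)`, the upper limit as `R → ∞` of `W(j, χ_R) / |B_R|`. -/
def energy (χ : ℝ → Plane → ℝ) (Λ : Set Plane) (j : Plane → Plane) : EReal :=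
  limsup (fun R : ℝ =>
    localEnergy Λ j (χ R) / ((volume.real (Metric.ball (0 : Plane) R) : ℝ) : EReal)) atTop

/-- The renormalized energy `W̃(Λ)` with background density `m`: the infimum of `W(j)` over all
`j` in `F_Λ` (not only over gradients), which is `+∞` if `F_Λ` is empty. -/
def tildeW (χ : ℝ → Plane → ℝ) (m : ℝ) (Λ : Set Plane) : EReal :=
  ⨅ j ∈ fields Λ m, energy χ Λ j

end RenormalizedEnergy

end

noncomputable section

namespace RenormalizedEnergy

/-! ### Counting points -/

/-! The infimum runs over all fields with the prescribed divergence, not only gradients, so it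
suffices to exhibit one field `j` that is bounded apart from a singularity of size `1/|x - p|` at
each point `p`.

The product structure turns the planar discrepancy bound into a one-dimensional one. A square of
side `R` contains about `R` identical rows, so dividing the error `C R` by `R` leaves a bounded
error for `Λ₁`: its counting function `N` satisfies `|N(x) - x| ≤ C + 3` (`abs_counting_sub_le`).

The competitor `field` transports charge in two stages. Around each point, `kernel` exchanges the
point charge for a uniform charge on the vertical unit segment centered there
(`integral_inner_kernel`). Since the second factor is `ℤ`, these segments tile the lines `{a} × ℝ`,
`a ∈ Λ₁`, with density one. The resulting charge depends on the first coordinate only and is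
balanced against the background by the horizontal field `-2π (N(x) - x)`, which is bounded by the
first step. The line charges cancel in `solvesDivEquation_field`.

The kernels are supported in disjoint thin boxes, so at each `x` at most one of them acts, and it is
at most `1/|x - p| + O(1)` (`norm_field_cases`). In polar coordinates each point costs `-π χ(p) log
η + O(1)`. The logarithm is removed exactly by the renormalization, and what remains is `O(1)` per
point and per unit area (`localEnergy_le`). There are `O(R²)` points in `B_R` (`card_window_le`), so
division by `|B_R|` leaves a bounded quantity. -/

theorem finite_of_separated_of_isBounded {X : Type*} [PseudoMetricSpace X] [ProperSpace X]
    {S : Set X} {δ : ℝ} (hδ : 0 < δ) (hS : ∀ p ∈ S, ∀ q ∈ S, p ≠ q → δ ≤ dist p q)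
    (hb : Bornology.IsBounded S) : S.Finite := by
  obtain ⟨t, ht, hcov⟩ := Metric.totallyBounded_iff.1
    ((hb.isCompact_closure.totallyBounded).subset subset_closure) (δ / 2) (by positivity)
  refine (ht.biUnion (t := fun y => S ∩ Metric.ball y (δ / 2)) fun y _ => ?_).subset ?_
  · refine Set.Subsingleton.finite fun p hp q hq => ?_
    by_contra hne
    have h1 := hS p hp.1 q hq.1 hne
    have h2 := dist_triangle_right p q y
    have h3 := Metric.mem_ball.1 hp.2
    have h4 := Metric.mem_ball.1 hq.2
    linarith
  · intro x hx
    obtain ⟨y, hy, hxy⟩ := Set.mem_iUnion₂.1 (hcov hx)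
    exact Set.mem_iUnion₂.2 ⟨y, hy, hx, hxy⟩

theorem IsUniform.finite_inter {Λ : Set Plane} (h : IsUniform Λ) {S : Set Plane}
    (hS : Bornology.IsBounded S) : (Λ ∩ S).Finite := by
  obtain ⟨δ, hδ, h⟩ := h
  exact finite_of_separated_of_isBounded hδ (fun p hp q hq => h p hp.1 q hq.1)
    (hS.subset Set.inter_subset_right)

/-- The product of `Λ₁` and the integers in `[0, R]`. -/
theorem prodInt_inter_square {Λ₁ : Set ℝ} (s R : ℝ) :
    prodInt Λ₁ ∩ square !₂[s + R / 2, R / 2] R =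
      (fun z : ℝ × ℤ => (!₂[z.1, (z.2 : ℝ)] : Plane)) ''
        ((Λ₁ ∩ Set.Icc s (s + R)) ×ˢ (Set.Icc 0 ⌊R⌋)) := by
  ext x
  simp only [prodInt, square, Set.mem_inter_iff, Set.mem_ofPred_eq, Set.mem_image, Set.mem_prod,
    Set.mem_Icc, Prod.exists, abs_le]
  constructor
  · rintro ⟨⟨h0, n, hn⟩, ⟨h1, h2⟩, h3, h4⟩
    refine ⟨x 0, n, ⟨⟨h0, ?_, ?_⟩, ?_, ?_⟩, ?_⟩
    · simp at h1 h2; linarith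
    · simp at h1 h2; linarith
    · simp [hn] at h3; exact_mod_cast h3
    · simp [hn] at h4; rw [Int.le_floor]; linarith
    · ext i; fin_cases i <;> simp [hn]
  · rintro ⟨a, n, ⟨⟨ha, h1, h2⟩, h3, h4⟩, rfl⟩
    rw [Int.le_floor] at h4
    have h3' : (0 : ℝ) ≤ n := by exact_mod_cast h3
    refine ⟨⟨by simpa using ha, n, by simp⟩, ⟨?_, ?_⟩, ?_, ?_⟩ <;> simp <;> linarith

/-- With its lower side at height `0`, the square contains exactly `⌊R⌋ + 1` rows, a number in `(R,
R + 1]`. Dividing `R² ± C R` by it gives an error independent of `R`; the extra `1` comes from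
dividing by `R + 1` in the lower bound. -/
theorem ncard_inter_Icc_bound {Λ₁ : Set ℝ} {C : ℝ}
    (hcount : ∀ (x : Plane) (R : ℝ), 1 < R →
      |((prodInt Λ₁ ∩ square x R).ncard : ℝ) - R ^ 2| ≤ C * R) (s : ℝ) {R : ℝ} (hR : 1 < R) :
    |((Λ₁ ∩ Set.Icc s (s + R)).ncard : ℝ) - R| ≤ C + 1 := by
  have h := hcount !₂[s + R / 2, R / 2] R hR
  rw [prodInt_inter_square, Set.ncard_image_of_injective, Set.ncard_prod] at h
  · have hM : ((Set.Icc (0 : ℤ) ⌊R⌋).ncard : ℝ) = ⌊R⌋ + 1 := by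
      rw [← Finset.coe_Icc, Set.ncard_coe_finset, Int.card_Icc]
      have : (0 : ℤ) ≤ ⌊R⌋ := Int.floor_nonneg.2 (by linarith)
      have h2 : ((⌊R⌋ + 1 - 0).toNat : ℤ) = ⌊R⌋ + 1 := by omega
      exact_mod_cast h2
    push_cast at h
    rw [hM] at h
    have h1 := Int.floor_le R
    have h2 := Int.lt_floor_add_one R
    set N : ℝ := ((Λ₁ ∩ Set.Icc s (s + R)).ncard : ℝ)
    have hN : 0 ≤ N := Nat.cast_nonneg _
    rw [abs_le] at h ⊢
    constructor
    · have h3 : R ^ 2 - C * R ≤ N * (R + 1) := by nlinarith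
      have hC : 0 ≤ C := by
        have := h.1.trans h.2
        by_contra hc
        nlinarith
      by_contra hc
      push Not at hc
      nlinarith
    · have h3 : N * R ≤ R ^ 2 + C * R := by nlinarith
      have h4 : N ≤ R + C := by
        by_contra hc
        push Not at hc
        nlinarith
      linarith
  · rintro ⟨a, n⟩ ⟨b, m⟩ hab
    have h0 := congrFun (congrArg WithLp.ofLp hab) 0
    have h1 := congrFun (congrArg WithLp.ofLp hab) 1
    simp at h0 h1
    simp [h0, h1]

/-- A primitive of the counting measure of `Λ₁`. -/
def counting (Λ₁ : Set ℝ) (x : ℝ) : ℝ :=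
  ((Λ₁ ∩ Set.Ioc 0 x).ncard : ℝ) - ((Λ₁ ∩ Set.Ioc x 0).ncard : ℝ)

theorem ncard_inter_Ioc_add {Λ₁ : Set ℝ} (hfin : ∀ a b, (Λ₁ ∩ Set.Icc a b).Finite) {a b c : ℝ}
    (hab : a ≤ b) (hbc : b ≤ c) :
    ((Λ₁ ∩ Set.Ioc a c).ncard : ℝ) = (Λ₁ ∩ Set.Ioc a b).ncard + (Λ₁ ∩ Set.Ioc b c).ncard := by
  have hf : ∀ a b, (Λ₁ ∩ Set.Ioc a b).Finite := fun a b =>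
    (hfin a b).subset (Set.inter_subset_inter_right _ Set.Ioc_subset_Icc_self)
  rw [← Set.Ioc_union_Ioc_eq_Ioc hab hbc, Set.inter_union_distrib_left,
    Set.ncard_union_eq ?_ (hf _ _) (hf _ _)]
  · push_cast; rfl
  · rw [Set.disjoint_left]
    rintro x ⟨-, -, hx⟩ ⟨-, hx', -⟩
    linarith

theorem counting_sub {Λ₁ : Set ℝ} (hfin : ∀ a b, (Λ₁ ∩ Set.Icc a b).Finite) {a b : ℝ}
    (hab : a ≤ b) : counting Λ₁ b - counting Λ₁ a = (Λ₁ ∩ Set.Ioc a b).ncard := by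
  have hempty : ∀ {c d : ℝ}, d ≤ c → ((Λ₁ ∩ Set.Ioc c d).ncard : ℝ) = 0 := fun h => by
    simp [Set.Ioc_eq_empty (not_lt.2 h)]
  unfold counting
  rcases le_total 0 a with ha | ha
  · rw [hempty ha, hempty (ha.trans hab), ncard_inter_Ioc_add hfin ha hab]; ring
  · rcases le_total 0 b with hb | hb
    · rw [hempty ha, hempty hb, ncard_inter_Ioc_add hfin ha hb]; ring
    · rw [hempty ha, hempty hb, ncard_inter_Ioc_add hfin hab hb]; ring

theorem monotone_counting {Λ₁ : Set ℝ} (hfin : ∀ a b, (Λ₁ ∩ Set.Icc a b).Finite) :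
    Monotone (counting Λ₁) := fun a b hab => by
  have := counting_sub hfin hab
  have h : (0 : ℝ) ≤ (Λ₁ ∩ Set.Ioc a b).ncard := Nat.cast_nonneg _
  linarith

theorem ncard_inter_Ioc_bound {Λ₁ : Set ℝ} (hfin : ∀ a b, (Λ₁ ∩ Set.Icc a b).Finite) {C : ℝ}
    (hcount : ∀ (x : Plane) (R : ℝ), 1 < R →
      |((prodInt Λ₁ ∩ square x R).ncard : ℝ) - R ^ 2| ≤ C * R) (hC : 0 ≤ C)
    {a b : ℝ} (hab : a ≤ b) :
    |((Λ₁ ∩ Set.Ioc a b).ncard : ℝ) - (b - a)| ≤ C + 3 := by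
  have hN : (0 : ℝ) ≤ (Λ₁ ∩ Set.Ioc a b).ncard := Nat.cast_nonneg _
  rcases lt_or_ge 1 (b - a) with h | h
  · have h1 := ncard_inter_Icc_bound hcount a h
    rw [add_sub_cancel] at h1
    have h2 : ((Λ₁ ∩ Set.Ioc a b).ncard : ℝ) ≤ (Λ₁ ∩ Set.Icc a b).ncard := by
      exact_mod_cast Set.ncard_le_ncard
        (Set.inter_subset_inter_right _ Set.Ioc_subset_Icc_self) (hfin a b)
    have h3 : ((Λ₁ ∩ Set.Icc a b).ncard : ℝ) ≤ (Λ₁ ∩ Set.Ioc a b).ncard + 1 := by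
      have hsub : Λ₁ ∩ Set.Icc a b ⊆ insert a (Λ₁ ∩ Set.Ioc a b) := by
        rintro x ⟨hx, hax, hxb⟩
        rcases hax.eq_or_lt with rfl | hlt
        · exact Set.mem_insert _ _
        · exact Set.mem_insert_of_mem _ ⟨hx, hlt, hxb⟩
      have := (Set.ncard_le_ncard hsub (((hfin a b).subset (Set.inter_subset_inter_right _
        Set.Ioc_subset_Icc_self)).insert a)).trans (Set.ncard_insert_le _ _)
      exact_mod_cast this
    rw [abs_le] at h1 ⊢
    constructor <;> linarith
  -- The hypothesis says nothing about sidelengths up to `1`, so a short interval is enlarged to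
  -- length `2`; this is where `C + 3 = 2 + (C + 1)` comes from.
  · have h1 := ncard_inter_Icc_bound hcount a (R := 2) (by norm_num)
    have h2 : ((Λ₁ ∩ Set.Ioc a b).ncard : ℝ) ≤ (Λ₁ ∩ Set.Icc a (a + 2)).ncard := by
      have hsub : Set.Ioc a b ⊆ Set.Icc a (a + 2) := fun x hx =>
        ⟨hx.1.le, hx.2.trans (by linarith)⟩
      exact_mod_cast Set.ncard_le_ncard (Set.inter_subset_inter_right _ hsub) (hfin a (a + 2))
    rw [abs_le] at h1 ⊢
    constructor <;> linarith

theorem abs_counting_sub_le {Λ₁ : Set ℝ} (hfin : ∀ a b, (Λ₁ ∩ Set.Icc a b).Finite) {C : ℝ}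
    (hcount : ∀ (x : Plane) (R : ℝ), 1 < R →
      |((prodInt Λ₁ ∩ square x R).ncard : ℝ) - R ^ 2| ≤ C * R) (hC : 0 ≤ C) (x : ℝ) :
    |counting Λ₁ x - x| ≤ C + 3 := by
  have h0 : counting Λ₁ 0 = 0 := by simp [counting]
  rcases le_total 0 x with h | h
  · have h1 := ncard_inter_Ioc_bound hfin hcount hC h
    have h2 := counting_sub hfin h
    rw [← h2, h0] at h1
    simpa using h1
  · have h1 := ncard_inter_Ioc_bound hfin hcount hC h
    have h2 := counting_sub hfin h
    rw [← h2, h0, abs_sub_comm] at h1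
    convert h1 using 2
    ring

/-! ### The kernel on a quadrant -/

/-- The stream function of the kernel on the positive quadrant. -/
def stream (ρ x y : ℝ) : ℝ := -((1 - 2 * y) * (1 - x / ρ) * Real.arctan (y / x))

/-- The derivative of the stream function in the second variable. -/
def ker₁ (ρ x y : ℝ) : ℝ :=
  2 * (1 - x / ρ) * Real.arctan (y / x) - (1 - 2 * y) * (1 - x / ρ) * (x / (x ^ 2 + y ^ 2))

/-- The opposite of the derivative of the stream function in the first variable. -/
def ker₂ (ρ x y : ℝ) : ℝ :=
  -((1 - 2 * y) / ρ * Real.arctan (y / x)) - (1 - 2 * y) * (1 - x / ρ) * (y / (x ^ 2 + y ^ 2))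

theorem hasDerivAt_stream_snd (ρ : ℝ) {x : ℝ} (hx : 0 < x) (y : ℝ) :
    HasDerivAt (fun y => stream ρ x y) (ker₁ ρ x y) y := by
  have h1 : HasDerivAt (fun y : ℝ => Real.arctan (y / x)) (1 / (1 + (y / x) ^ 2) * (1 / x)) y :=
    ((hasDerivAt_id y).div_const x).arctan
  have h2 : HasDerivAt (fun y : ℝ => (1 - 2 * y) * (1 - x / ρ)) (-2 * (1 - x / ρ)) y := by
    have := (((hasDerivAt_id y).const_mul 2).const_sub 1).mul_const (1 - x / ρ)
    simpa using this
  refine (h2.mul h1).neg.congr_deriv ?_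
  unfold ker₁
  have : x ^ 2 + y ^ 2 ≠ 0 := by positivity
  have e : 1 / (1 + (y / x) ^ 2) * (1 / x) = x / (x ^ 2 + y ^ 2) := by
    field_simp
  rw [e]; ring

theorem arctan_div_eq {x y : ℝ} (hx : 0 < x) (hy : 0 < y) :
    Real.arctan (y / x) = Real.pi / 2 - Real.arctan (x / y) := by
  rw [← Real.arctan_inv_of_pos (div_pos hx hy), inv_div]

/-- At `x = 0` the term `arctan (y / x)` takes the junk value `0`, whereas its limit from the right
is `π / 2`. Rewritten with `π / 2 - arctan (x / y)`, the stream function is smooth across `x = 0`,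
and integration by parts down to the axis sees the correct boundary value. -/
theorem hasDerivAt_stream_fst (ρ : ℝ) (x : ℝ) {y : ℝ} (hy : 0 < y) :
    HasDerivAt (fun x => -((1 - 2 * y) * (1 - x / ρ) * (Real.pi / 2 - Real.arctan (x / y))))
      ((1 - 2 * y) / ρ * (Real.pi / 2 - Real.arctan (x / y))
        + (1 - 2 * y) * (1 - x / ρ) * (y / (x ^ 2 + y ^ 2))) x := by
  have h1 : HasDerivAt (fun x : ℝ => Real.pi / 2 - Real.arctan (x / y))
      (-(1 / (1 + (x / y) ^ 2) * (1 / y))) x :=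
    (((hasDerivAt_id x).div_const y).arctan).const_sub _
  have h2 : HasDerivAt (fun x : ℝ => (1 - 2 * y) * (1 - x / ρ)) ((1 - 2 * y) * (-(1 / ρ))) x :=
    (((hasDerivAt_id x).div_const ρ).const_sub 1).const_mul (1 - 2 * y)
  refine (h2.mul h1).neg.congr_deriv ?_
  have : x ^ 2 + y ^ 2 ≠ 0 := by positivity
  have e : 1 / (1 + (x / y) ^ 2) * (1 / y) = y / (x ^ 2 + y ^ 2) := by
    field_simp; ring
  rw [e]; ring

theorem abs_arctan_le_two (t : ℝ) : |Real.arctan t| ≤ 2 := by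
  rw [abs_le]
  constructor <;> linarith [Real.arctan_lt_pi_div_two t, Real.neg_pi_div_two_lt_arctan t,
    Real.pi_le_four]

theorem one_sub_mem {t : ℝ} (h0 : 0 ≤ t) (h1 : t ≤ 1) : |1 - t| ≤ 1 := by
  rw [abs_le]; constructor <;> linarith

/-- A majorant in product form, each factor integrable at `0`, gives integrability of the kernel at
the corner of the quadrant without polar coordinates. -/
theorem div_sq_add_sq_le {x y : ℝ} (hx : 0 < x) (hy : 0 < y) :
    x / (x ^ 2 + y ^ 2) ≤ x ^ (-(1 / 2) : ℝ) * y ^ (-(1 / 2) : ℝ) := by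
  rw [Real.rpow_neg hx.le, Real.rpow_neg hy.le, ← Real.sqrt_eq_rpow, ← Real.sqrt_eq_rpow,
    ← mul_inv, ← one_div, div_le_div_iff₀ (by positivity) (by positivity)]
  obtain ⟨a, ha, rfl⟩ : ∃ a, 0 < a ∧ a ^ 2 = x := ⟨√x, Real.sqrt_pos.2 hx, Real.sq_sqrt hx.le⟩
  obtain ⟨b, hb, rfl⟩ : ∃ a, 0 < a ∧ a ^ 2 = y := ⟨√y, Real.sqrt_pos.2 hy, Real.sq_sqrt hy.le⟩
  rw [Real.sqrt_sq ha.le, Real.sqrt_sq hb.le]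
  have h1 : 2 * (a * b) ≤ a ^ 2 + b ^ 2 := by nlinarith [sq_nonneg (a - b)]
  have h2 : a ^ 2 * (2 * (a * b)) ≤ a ^ 2 * (a ^ 2 + b ^ 2) := by gcongr
  have h3 : 0 ≤ (a ^ 2 - b ^ 2) ^ 2 := sq_nonneg _
  have h4 : 0 ≤ (a ^ 2) ^ 2 := by positivity
  have h5 : 0 ≤ (b ^ 2) ^ 2 := by positivity
  nlinarith

theorem integrableOn_rect_rpow (a b : ℝ) :
    IntegrableOn (fun z : ℝ × ℝ => z.1 ^ (-(1 / 2) : ℝ) * z.2 ^ (-(1 / 2) : ℝ))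
      (Set.Ioc 0 a ×ˢ Set.Ioc 0 b) := by
  have h : ∀ c : ℝ, IntegrableOn (fun x : ℝ => x ^ (-(1 / 2) : ℝ)) (Set.Ioc 0 c) := fun c =>
    (intervalIntegral.intervalIntegrable_rpow' (a := 0) (b := c) (by norm_num)).1
  have := (h a).mul_prod (h b)
  rwa [Measure.prod_restrict] at this

theorem measurable_ker₁ (ρ : ℝ) : Measurable fun z : ℝ × ℝ => ker₁ ρ z.1 z.2 := by
  unfold ker₁; fun_prop

theorem measurable_ker₂ (ρ : ℝ) : Measurable fun z : ℝ × ℝ => ker₂ ρ z.1 z.2 := by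
  unfold ker₂; fun_prop

theorem measurable_stream (ρ : ℝ) : Measurable fun z : ℝ × ℝ => stream ρ z.1 z.2 := by
  unfold stream; fun_prop

theorem integrableOn_ker₁ {ρ : ℝ} (hρ : 0 < ρ) :
    IntegrableOn (fun z : ℝ × ℝ => ker₁ ρ z.1 z.2) (Set.Ioc 0 ρ ×ˢ Set.Ioc 0 (1 / 2)) := by
  refine Integrable.mono' ((integrableOn_const (C := (4 : ℝ)) (by
    rw [Measure.volume_eq_prod, Measure.prod_prod]; simp [ENNReal.mul_ne_top])).add
      (integrableOn_rect_rpow _ _))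
    (measurable_ker₁ ρ).aestronglyMeasurable ?_
  refine (ae_restrict_iff' (measurableSet_Ioc.prod measurableSet_Ioc)).2 (.of_forall ?_)
  rintro ⟨x, y⟩ ⟨⟨hx, hx'⟩, hy, hy'⟩
  simp only at hx hx' hy hy'
  have h1 : |1 - x / ρ| ≤ 1 := one_sub_mem (by positivity) ((div_le_one hρ).2 hx')
  have h2 : |1 - 2 * y| ≤ 1 := one_sub_mem (by positivity) (by linarith)
  have h3 := div_sq_add_sq_le hx hy
  rw [Real.norm_eq_abs]
  refine (abs_sub _ _).trans (add_le_add ?_ ?_)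
  · rw [abs_mul, abs_mul, abs_two]
    nlinarith [abs_arctan_le_two (y / x), abs_nonneg (Real.arctan (y / x)), abs_nonneg (1 - x / ρ)]
  · rw [abs_mul, abs_mul, abs_of_nonneg (a := x / _) (by positivity)]
    calc _ ≤ 1 * 1 * (x / (x ^ 2 + y ^ 2)) := by gcongr
      _ ≤ _ := by simpa using h3

theorem integrableOn_ker₂ {ρ : ℝ} (hρ : 0 < ρ) :
    IntegrableOn (fun z : ℝ × ℝ => ker₂ ρ z.1 z.2) (Set.Ioc 0 ρ ×ˢ Set.Ioc 0 (1 / 2)) := by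
  refine Integrable.mono' ((integrableOn_const (C := (1 / ρ * 2 : ℝ)) (by
    rw [Measure.volume_eq_prod, Measure.prod_prod]; simp [ENNReal.mul_ne_top])).add
      (integrableOn_rect_rpow _ _))
    (measurable_ker₂ ρ).aestronglyMeasurable ?_
  refine (ae_restrict_iff' (measurableSet_Ioc.prod measurableSet_Ioc)).2 (.of_forall ?_)
  rintro ⟨x, y⟩ ⟨⟨hx, hx'⟩, hy, hy'⟩
  simp only at hx hx' hy hy'
  have h1 : |1 - x / ρ| ≤ 1 := one_sub_mem (by positivity) ((div_le_one hρ).2 hx')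
  have h2 : |1 - 2 * y| ≤ 1 := one_sub_mem (by positivity) (by linarith)
  have h3 := div_sq_add_sq_le hy hx
  rw [Real.norm_eq_abs]
  refine (abs_sub _ _).trans (add_le_add ?_ ?_)
  · rw [abs_neg, abs_mul, abs_div, abs_of_pos hρ]
    have h4 := abs_arctan_le_two (y / x)
    exact mul_le_mul ((div_le_div_iff_of_pos_right hρ).2 h2) h4 (abs_nonneg _) (by positivity)
  · rw [abs_mul, abs_mul, abs_of_nonneg (a := y / _) (by positivity)]
    calc _ ≤ 1 * 1 * (y / (x ^ 2 + y ^ 2)) := by gcongr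
      _ ≤ _ := by simpa [add_comm, mul_comm] using h3

theorem abs_stream_le {ρ x y : ℝ} (hx : x ∈ Set.Ioc 0 ρ) (hy : y ∈ Set.Ioc 0 (1 / 2 : ℝ)) :
    |stream ρ x y| ≤ 2 := by
  have hρ : 0 < ρ := hx.1.trans_le hx.2
  have h1 : |1 - x / ρ| ≤ 1 :=
    one_sub_mem (div_nonneg hx.1.le hρ.le) ((div_le_one hρ).2 hx.2)
  have h2 : |1 - 2 * y| ≤ 1 := one_sub_mem (by linarith [hy.1]) (by linarith [hy.2])
  unfold stream
  rw [abs_neg, abs_mul, abs_mul]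
  have := abs_arctan_le_two (y / x)
  calc _ ≤ 1 * 1 * (2 : ℝ) := by gcongr
    _ = 2 := by norm_num

theorem integrableOn_mul_of_continuous {k g : ℝ × ℝ → ℝ} {a b : ℝ}
    (hk : IntegrableOn k (Set.Ioc 0 a ×ˢ Set.Ioc 0 b)) (hg : Continuous g) :
    IntegrableOn (fun z => k z * g z) (Set.Ioc 0 a ×ˢ Set.Ioc 0 b) := by
  obtain ⟨M, hM⟩ := (isCompact_Icc.prod isCompact_Icc : IsCompact
    (Set.Icc (0 : ℝ) a ×ˢ Set.Icc (0 : ℝ) b)).exists_bound_of_continuousOn hg.continuousOn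
  refine Integrable.mul_bdd (c := M) hk hg.aestronglyMeasurable ?_
  refine (ae_restrict_iff' (measurableSet_Ioc.prod measurableSet_Ioc)).2 (.of_forall ?_)
  exact fun z hz => hM z ⟨Set.Ioc_subset_Icc_self hz.1, Set.Ioc_subset_Icc_self hz.2⟩

/-- The weak form, on the positive quadrant, of the divergence of the kernel. -/
theorem integral_ker_quadrant {ρ : ℝ} (hρ : 0 < ρ) {f fx fy fxy : ℝ → ℝ → ℝ}
    (hfx : Continuous fun z : ℝ × ℝ => fx z.1 z.2)
    (hfy : Continuous fun z : ℝ × ℝ => fy z.1 z.2)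
    (hfxy : Continuous fun z : ℝ × ℝ => fxy z.1 z.2)
    (h1 : ∀ y, HasDerivAt (fun y => f 0 y) (fy 0 y) y)
    (h2 : ∀ x y, HasDerivAt (fun y => fx x y) (fxy x y) y)
    (h3 : ∀ x y, HasDerivAt (fun x => fy x y) (fxy x y) x) :
    ∫ z in Set.Ioc 0 ρ ×ˢ Set.Ioc 0 (1 / 2 : ℝ),
        (ker₁ ρ z.1 z.2 * fx z.1 z.2 + ker₂ ρ z.1 z.2 * fy z.1 z.2)
      = Real.pi / 2 * f 0 0 - Real.pi * ∫ y in (0 : ℝ)..(1 / 2), f 0 y := by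
  have I1 := integrableOn_mul_of_continuous (integrableOn_ker₁ hρ) hfx
  have I2 := integrableOn_mul_of_continuous (integrableOn_ker₂ hρ) hfy
  have I3 : IntegrableOn (fun z : ℝ × ℝ => stream ρ z.1 z.2 * fxy z.1 z.2)
      (Set.Ioc 0 ρ ×ˢ Set.Ioc 0 (1 / 2 : ℝ)) := by
    refine integrableOn_mul_of_continuous ?_ hfxy
    refine Integrable.mono' (integrableOn_const (C := (2 : ℝ)) (by
      rw [Measure.volume_eq_prod, Measure.prod_prod]; simp [ENNReal.mul_ne_top]))
      (measurable_stream ρ).aestronglyMeasurable ?_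
    refine (ae_restrict_iff' (measurableSet_Ioc.prod measurableSet_Ioc)).2 (.of_forall ?_)
    exact fun z hz => abs_stream_le hz.1 hz.2
  rw [integral_add I1 I2]
  have c2 : ∀ {g : ℝ → ℝ → ℝ}, (Continuous fun z : ℝ × ℝ => g z.1 z.2) →
      ∀ x, Continuous fun y => g x y := fun hg x =>
    hg.comp (continuous_const.prodMk continuous_id)
  have c1 : ∀ {g : ℝ → ℝ → ℝ}, (Continuous fun z : ℝ × ℝ => g z.1 z.2) →
      ∀ y, Continuous fun x => g x y := fun hg y =>
    hg.comp (continuous_id.prodMk continuous_const)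
  -- Integration by parts in `y` has no boundary terms: the stream function vanishes at `y = 0`
  -- through the arctangent and at `y = 1/2` through the factor `1 - 2y`.
  have T1 : ∫ z in Set.Ioc 0 ρ ×ˢ Set.Ioc 0 (1 / 2 : ℝ), ker₁ ρ z.1 z.2 * fx z.1 z.2
      = -∫ z in Set.Ioc 0 ρ ×ˢ Set.Ioc 0 (1 / 2 : ℝ), stream ρ z.1 z.2 * fxy z.1 z.2 := by
    rw [Measure.volume_eq_prod, setIntegral_prod _ I1, setIntegral_prod _ I3, ← integral_neg]
    refine setIntegral_congr_fun measurableSet_Ioc fun x hx => ?_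
    simp only
    rw [← intervalIntegral.integral_of_le (by norm_num), ← intervalIntegral.integral_of_le
      (by norm_num)]
    have hk : Continuous fun y => ker₁ ρ x y := by
      unfold ker₁
      have : ∀ y : ℝ, x ^ 2 + y ^ 2 ≠ 0 := fun y => by have := hx.1; positivity
      fun_prop (disch := assumption)
    have := intervalIntegral.integral_mul_deriv_eq_deriv_mul (a := 0) (b := 1 / 2)
      (u := fun y => stream ρ x y) (v := fun y => fx x y)
      (fun y _ => hasDerivAt_stream_snd ρ hx.1 y) (fun y _ => h2 x y)
      (hk.intervalIntegrable _ _) ((c2 hfxy x).intervalIntegrable _ _)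
    rw [this]
    simp [stream]
  -- Integration by parts in `x` produces the opposite mixed term, which cancels that of `T1`. The
  -- side `x = ρ` contributes nothing; the axis `x = 0` contributes the trace `-(1 - 2y) π / 2` of
  -- the stream function.
  have T2 : ∫ z in Set.Ioc 0 ρ ×ˢ Set.Ioc 0 (1 / 2 : ℝ), ker₂ ρ z.1 z.2 * fy z.1 z.2
      = (∫ z in Set.Ioc 0 ρ ×ˢ Set.Ioc 0 (1 / 2 : ℝ), stream ρ z.1 z.2 * fxy z.1 z.2)
        + ∫ y in (0 : ℝ)..(1 / 2), -((1 - 2 * y) * (Real.pi / 2)) * fy 0 y := by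
    have hint : IntegrableOn (fun y => -((1 - 2 * y) * (Real.pi / 2)) * fy 0 y)
        (Set.Ioc 0 (1 / 2)) := by
      have : Continuous fun y => -((1 - 2 * y) * (Real.pi / 2)) * fy 0 y := by
        have := c2 hfy 0
        fun_prop
      exact (this.intervalIntegrable 0 (1 / 2)).1
    rw [IntegrableOn, Measure.volume_eq_prod, ← Measure.prod_restrict] at I2 I3
    rw [Measure.volume_eq_prod, ← Measure.prod_restrict, integral_prod_symm _ I2,
      integral_prod_symm _ I3, intervalIntegral.integral_of_le (by norm_num),
      ← integral_add I3.integral_prod_right hint]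
    refine setIntegral_congr_fun measurableSet_Ioc fun y hy => ?_
    simp only
    have hk : Continuous fun x => (1 - 2 * y) / ρ * (Real.pi / 2 - Real.arctan (x / y))
        + (1 - 2 * y) * (1 - x / ρ) * (y / (x ^ 2 + y ^ 2)) := by
      have : ∀ x : ℝ, x ^ 2 + y ^ 2 ≠ 0 := fun x => by have := hy.1; positivity
      fun_prop (disch := assumption)
    have key := intervalIntegral.integral_mul_deriv_eq_deriv_mul (a := 0) (b := ρ)
      (u := fun x => -((1 - 2 * y) * (1 - x / ρ) * (Real.pi / 2 - Real.arctan (x / y))))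
      (v := fun x => fy x y)
      (fun x _ => hasDerivAt_stream_fst ρ x hy.1) (fun x _ => h3 x y)
      (hk.intervalIntegrable _ _) ((c1 hfxy y).intervalIntegrable _ _)
    rw [intervalIntegral.integral_of_le hρ.le, intervalIntegral.integral_of_le hρ.le] at key
    have e1 : ∫ x in Set.Ioc 0 ρ, stream ρ x y * fxy x y = ∫ x in Set.Ioc 0 ρ,
        -((1 - 2 * y) * (1 - x / ρ) * (Real.pi / 2 - Real.arctan (x / y))) * fxy x y :=
      setIntegral_congr_fun measurableSet_Ioc fun x hx => by
        simp only [stream, arctan_div_eq hx.1 hy.1]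
    have e2 : ∫ x in Set.Ioc 0 ρ, ker₂ ρ x y * fy x y = -∫ x in Set.Ioc 0 ρ,
        ((1 - 2 * y) / ρ * (Real.pi / 2 - Real.arctan (x / y))
          + (1 - 2 * y) * (1 - x / ρ) * (y / (x ^ 2 + y ^ 2))) * fy x y := by
      rw [← integral_neg]
      refine setIntegral_congr_fun measurableSet_Ioc fun x hx => ?_
      simp only [ker₂, arctan_div_eq hx.1 hy.1]
      ring
    rw [e1, e2, key]
    simp [div_self hρ.ne']
    ring
  -- The trace is affine in `y` with slope `π`: its jump at the origin is a quarter of the point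
  -- charge, and its slope is the uniform charge on the axis.
  have T3 : ∫ y in (0 : ℝ)..(1 / 2), -((1 - 2 * y) * (Real.pi / 2)) * fy 0 y
      = Real.pi / 2 * f 0 0 - Real.pi * ∫ y in (0 : ℝ)..(1 / 2), f 0 y := by
    have hd : ∀ y : ℝ, HasDerivAt (fun y => -((1 - 2 * y) * (Real.pi / 2))) Real.pi y := fun y => by
      refine ((((hasDerivAt_id y).const_mul 2).const_sub 1).mul_const
        (Real.pi / 2)).neg.congr_deriv ?_
      ring
    rw [intervalIntegral.integral_mul_deriv_eq_deriv_mul (fun y _ => hd y) (fun y _ => h1 y)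
      (continuous_const.intervalIntegrable _ _) ((c2 hfy 0).intervalIntegrable _ _),
      intervalIntegral.integral_const_mul]
    simp
  rw [T1, T2, T3]; ring

/-! ### The kernel in the plane -/

/-- A field with flux `2π` into the origin, supported in a rectangle, whose divergence is otherwise
carried by the vertical axis of the rectangle. -/
def kernel (ρ : ℝ) (z : Plane) : Plane :=
  if |z 0| < ρ ∧ |z 1| < 1 / 2 then
    !₂[z 0 / |z 0| * ker₁ ρ |z 0| |z 1|, z 1 / |z 1| * ker₂ ρ |z 0| |z 1|] else 0

theorem kernel_eq_zero {ρ : ℝ} {z : Plane} (h : ¬(|z 0| < ρ ∧ |z 1| < 1 / 2)) : kernel ρ z = 0 :=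
  if_neg h

theorem norm_sq_eq (z : Plane) : ‖z‖ ^ 2 = z 0 ^ 2 + z 1 ^ 2 := by
  simp [EuclideanSpace.norm_sq_eq]

theorem norm_le_abs_add_abs (z : Plane) : ‖z‖ ≤ |z 0| + |z 1| := by
  refine abs_le_of_sq_le_sq' ?_ (by positivity) |>.2
  rw [norm_sq_eq]
  nlinarith [sq_abs (z 0), sq_abs (z 1), mul_nonneg (abs_nonneg (z 0)) (abs_nonneg (z 1))]

theorem norm_lt_one_of_mem_box {ρ : ℝ} (hρ : ρ ≤ 1 / 2) {z : Plane}
    (h : |z 0| < ρ ∧ |z 1| < 1 / 2) : ‖z‖ < 1 := by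
  linarith [norm_le_abs_add_abs z]

theorem measurable_kernel (ρ : ℝ) : Measurable (kernel ρ) := by
  unfold kernel
  refine Measurable.ite ?_ ?_ measurable_const
  · apply MeasurableSet.inter
    · exact measurableSet_lt (f := fun z : Plane => |z 0|) (by fun_prop) measurable_const
    · exact measurableSet_lt (f := fun z : Plane => |z 1|) (by fun_prop) measurable_const
  · refine (WithLp.measurable_toLp 2 _).comp (measurable_pi_iff.2 fun i => ?_)
    have h1 : Measurable fun z : Plane => ker₁ ρ |z 0| |z 1| :=
      (measurable_ker₁ ρ).comp (by fun_prop : Measurable fun z : Plane => (|z 0|, |z 1|))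
    have h2 : Measurable fun z : Plane => ker₂ ρ |z 0| |z 1| :=
      (measurable_ker₂ ρ).comp (by fun_prop : Measurable fun z : Plane => (|z 0|, |z 1|))
    fin_cases i
    · simpa using (by fun_prop : Measurable fun z : Plane => z 0 / |z 0| * ker₁ ρ |z 0| |z 1|)
    · simpa using (by fun_prop : Measurable fun z : Plane => z 1 / |z 1| * ker₂ ρ |z 0| |z 1|)

theorem abs_div_abs_self_le (x : ℝ) : |(x / |x|)| ≤ 1 := by
  rw [abs_div, abs_abs]; exact div_self_le_one _

theorem div_abs_mul_abs (x : ℝ) : x / |x| * |x| = x := by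
  rcases eq_or_ne x 0 with rfl | h
  · simp
  · exact div_mul_cancel₀ _ (abs_ne_zero.2 h)

/-- Differentiating the angle gives `-c z / |z|²` with `|c| ≤ 1`; differentiating the cut-off
factors gives bounded terms. The coefficient `1` in front of `1/|z|` is essential: it makes the
logarithm of the energy match the renormalization exactly. -/
theorem norm_kernel_le {ρ : ℝ} (hρ : 0 < ρ) (z : Plane) :
    ‖kernel ρ z‖ ≤ ‖z‖⁻¹ + (4 + 2 / ρ) := by
  by_cases h : |z 0| < ρ ∧ |z 1| < 1 / 2
  swap
  · rw [kernel_eq_zero h, norm_zero]; positivity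
  set c : ℝ := (1 - 2 * |z 1|) * (1 - |z 0| / ρ)
  set θ : ℝ := Real.arctan (|z 1| / |z 0|)
  have hθ : |θ| ≤ 2 := abs_arctan_le_two _
  have h1 : |1 - |z 0| / ρ| ≤ 1 := one_sub_mem (by positivity) ((div_le_one hρ).2 h.1.le)
  have h2 : |(1 - 2 * |z 1|)| ≤ 1 := one_sub_mem (by positivity) (by linarith [h.2])
  have e : kernel ρ z = (-(c / ‖z‖ ^ 2)) • z
      + !₂[z 0 / |z 0| * (2 * (1 - |z 0| / ρ) * θ), z 1 / |z 1| * -((1 - 2 * |z 1|) / ρ * θ)] := by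
    rw [kernel, if_pos h, norm_sq_eq]
    ext i
    fin_cases i
    · have := div_abs_mul_abs (z 0)
      simp only [ker₁, sq_abs, Fin.zero_eta, PiLp.add_apply, PiLp.smul_apply,
        smul_eq_mul, Matrix.cons_val_zero]
      calc _ = z 0 / |z 0| * (2 * (1 - |z 0| / ρ) * θ)
            - c * (z 0 / |z 0| * |z 0|) / (z 0 ^ 2 + z 1 ^ 2) := by ring
        _ = _ := by rw [this]; ring
    · have := div_abs_mul_abs (z 1)
      simp only [ker₂, sq_abs, Fin.mk_one, PiLp.add_apply, PiLp.smul_apply,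
        smul_eq_mul, Matrix.cons_val_one, Matrix.cons_val_zero]
      calc _ = z 1 / |z 1| * -((1 - 2 * |z 1|) / ρ * θ)
            - c * (z 1 / |z 1| * |z 1|) / (z 0 ^ 2 + z 1 ^ 2) := by ring
        _ = _ := by rw [this]; ring
  rw [e]
  refine (norm_add_le _ _).trans (add_le_add ?_ ((norm_le_abs_add_abs _).trans (add_le_add ?_ ?_)))
  · rw [norm_smul, norm_neg, norm_div, norm_pow, norm_norm, Real.norm_eq_abs]
    rcases eq_or_ne z 0 with rfl | hz
    · simp
    · have hz' : 0 < ‖z‖ := norm_pos_iff.2 hz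
      have hc : |c| ≤ 1 := by
        rw [abs_mul]; exact mul_le_one₀ h2 (abs_nonneg _) h1
      rw [div_mul_eq_mul_div, div_le_iff₀ (by positivity)]
      field_simp
      exact hc
  · simp only [Matrix.cons_val_zero]
    rw [abs_mul, abs_mul, abs_mul, abs_two]
    have := abs_div_abs_self_le (z 0)
    calc _ ≤ 1 * (2 * 1 * (2 : ℝ)) := by gcongr
      _ = 4 := by norm_num
  · simp only [Matrix.cons_val_one, Matrix.cons_val_zero]
    rw [abs_mul, abs_neg, abs_mul, abs_div (1 - 2 * |z 1|) ρ, abs_of_pos hρ]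
    have h3 := abs_div_abs_self_le (z 1)
    have h4 := (div_le_div_iff_of_pos_right hρ).2 h2
    calc _ ≤ 1 * (1 / ρ * (2 : ℝ)) := by gcongr
      _ = 2 / ρ := by ring

theorem integrableOn_inv_norm (r : ℝ) :
    IntegrableOn (fun z : Plane => ‖z‖⁻¹) (Metric.ball 0 r) := by
  have := (integrableOn_fun_norm_addHaar (volume : Measure Plane) (f := fun y => y⁻¹) (r := r)).2
  refine this (IntegrableOn.congr_fun (integrableOn_const (C := (1 : ℝ)) (by simp)) ?_
    measurableSet_Ioo)
  intro y hy
  have : y ≠ 0 := hy.1.ne'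
  simp [this]

theorem integrable_kernel {ρ : ℝ} (hρ : 0 < ρ) (hρ' : ρ ≤ 1 / 2) : Integrable (kernel ρ) := by
  have h : IntegrableOn (fun z : Plane => ‖z‖⁻¹ + (4 + 2 / ρ)) (Metric.ball 0 1) :=
    (integrableOn_inv_norm 1).add (integrableOn_const measure_ball_lt_top.ne)
  refine Integrable.mono' ((integrable_indicator_iff measurableSet_ball).2 h)
    (measurable_kernel ρ).aestronglyMeasurable (.of_forall fun z => ?_)
  by_cases hz : z ∈ Metric.ball (0 : Plane) 1
  · rw [Set.indicator_of_mem hz]; exact norm_kernel_le hρ z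
  · rw [Set.indicator_of_notMem hz, kernel_eq_zero, norm_zero]
    exact fun h => hz (mem_ball_zero_iff.2 (norm_lt_one_of_mem_box hρ' h))

/-! ### Partial derivatives -/

/-- The partial derivative of a function on the plane. -/
def pd (i : Fin 2) (φ : Plane → ℝ) (z : Plane) : ℝ := fderiv ℝ φ z (EuclideanSpace.single i 1)

theorem eq_smul_single_add (v : Plane) :
    v = v 0 • EuclideanSpace.single 0 1 + v 1 • EuclideanSpace.single 1 1 := by
  ext i; fin_cases i <;> simp

theorem fderiv_apply_eq (φ : Plane → ℝ) (z v : Plane) :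
    fderiv ℝ φ z v = v 0 * pd 0 φ z + v 1 * pd 1 φ z := by
  conv_lhs => rw [eq_smul_single_add v]
  simp [pd]

theorem inner_gradient_eq (φ : Plane → ℝ) (z v : Plane) :
    inner ℝ v (gradient φ z) = v 0 * pd 0 φ z + v 1 * pd 1 φ z := by
  rw [inner_gradient_right, ← fderiv_apply_eq]; rfl

theorem ContDiff.pd {φ : Plane → ℝ} (hφ : ContDiff ℝ ∞ φ) (i : Fin 2) :
    ContDiff ℝ ∞ (pd i φ) := by
  unfold RenormalizedEnergy.pd
  exact (hφ.fderiv_right (m := ∞) (by simp)).clm_apply contDiff_const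

theorem pd_comm {φ : Plane → ℝ} (hφ : ContDiff ℝ ∞ φ) (z : Plane) :
    pd 0 (pd 1 φ) z = pd 1 (pd 0 φ) z := by
  have hd : DifferentiableAt ℝ (fderiv ℝ φ) z :=
    (hφ.fderiv_right (m := ∞) (by simp)).differentiable (by simp) z
  have e : ∀ i j : Fin 2, pd i (pd j φ) z = fderiv ℝ (fderiv ℝ φ) z (EuclideanSpace.single i 1)
      (EuclideanSpace.single j 1) := fun i j => by
    unfold pd
    rw [fderiv_clm_apply hd (differentiableAt_const _)]
    simp
  rw [e, e]
  exact (hφ.contDiffAt.isSymmSndFDerivAt (by simp; norm_cast)) _ _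

theorem hasDerivAt_fst {φ : Plane → ℝ} (hφ : ContDiff ℝ ∞ φ) (s : ℝ) (x b : ℝ) :
    HasDerivAt (fun x => φ !₂[s * x, b]) (s * pd 0 φ !₂[s * x, b]) x := by
  have h1 : HasDerivAt (fun x => (!₂[s * x, b] : Plane)) (s • EuclideanSpace.single 0 1) x := by
    have e : (fun x => (!₂[s * x, b] : Plane)) = fun x =>
        x • (s • EuclideanSpace.single 0 1 : Plane) + b • EuclideanSpace.single 1 1 := by
      ext x i
      fin_cases i <;> simp [mul_comm]
    rw [e]
    simpa using ((hasDerivAt_id x).smul_const (s • EuclideanSpace.single 0 1 : Plane)).add_const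
      (b • EuclideanSpace.single 1 1 : Plane)
  have h2 := (hφ.differentiable (by simp) (!₂[s * x, b])).hasFDerivAt.comp_hasDerivAt x h1
  exact h2.congr_deriv (by simp [pd])

theorem hasDerivAt_snd {φ : Plane → ℝ} (hφ : ContDiff ℝ ∞ φ) (t : ℝ) (a y : ℝ) :
    HasDerivAt (fun y => φ !₂[a, t * y]) (t * pd 1 φ !₂[a, t * y]) y := by
  have h1 : HasDerivAt (fun y => (!₂[a, t * y] : Plane)) (t • EuclideanSpace.single 1 1) y := by
    have e : (fun y => (!₂[a, t * y] : Plane)) = fun y =>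
        y • (t • EuclideanSpace.single 1 1 : Plane) + a • EuclideanSpace.single 0 1 := by
      ext y i
      fin_cases i <;> simp [mul_comm]
    rw [e]
    simpa using ((hasDerivAt_id y).smul_const (t • EuclideanSpace.single 1 1 : Plane)).add_const
      (a • EuclideanSpace.single 0 1 : Plane)
  have h2 := (hφ.differentiable (by simp) (!₂[a, t * y])).hasFDerivAt.comp_hasDerivAt y h1
  exact h2.congr_deriv (by simp [pd])

/-! ### Integrals in coordinates -/

/-- Coordinates on the plane, as a measurable equivalence. -/
def coordEquiv : Plane ≃ᵐ ℝ × ℝ :=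
  (MeasurableEquiv.toLp 2 (Fin 2 → ℝ)).symm.trans MeasurableEquiv.finTwoArrow

theorem measurePreserving_coordEquiv : MeasurePreserving coordEquiv :=
  (volume_preserving_finTwoArrow ℝ).comp (PiLp.volume_preserving_ofLp (Fin 2))

theorem integral_plane (G : Plane → ℝ) : ∫ z, G z = ∫ z : ℝ × ℝ, G !₂[z.1, z.2] := by
  rw [← measurePreserving_coordEquiv.symm.integral_comp coordEquiv.symm.measurableEmbedding]
  rfl

theorem Integrable.comp_toPlane {G : Plane → ℝ} (hG : Integrable G) :
    Integrable fun z : ℝ × ℝ => G !₂[z.1, z.2] :=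
  (measurePreserving_coordEquiv.symm.integrable_comp_emb
    coordEquiv.symm.measurableEmbedding).2 hG

/-- The involution exchanges `H` and its complement up to a null set. Applied once per coordinate,
it folds the plane onto a quadrant. -/
theorem integral_eq_add_integral_comp {α : Type*} [MeasurableSpace α] {μ : Measure α}
    {σ : α → α} (hσ : MeasurePreserving σ μ μ) (hσ' : MeasurableEmbedding σ)
    (hinv : Function.Involutive σ) {H : Set α} (hH : MeasurableSet H) (hae : σ ⁻¹' H =ᵐ[μ] Hᶜ)
    {G : α → ℝ} (hG : Integrable G μ) :
    ∫ z, G z ∂μ = ∫ z in H, G z ∂μ + ∫ z in H, G (σ z) ∂μ := by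
  have h : ∫ z in Hᶜ, G z ∂μ = ∫ z in σ ⁻¹' H, G z ∂μ := setIntegral_congr_set hae.symm
  rw [← integral_add_compl hH hG, h,
    ← hσ.setIntegral_preimage_emb hσ' (fun z => G (σ z))]
  simp [hinv _]

theorem integral_fold {G : ℝ × ℝ → ℝ} (hG : Integrable G) :
    ∫ z, G z = ∫ z in Set.Ioi 0 ×ˢ Set.Ioi 0, (G (z.1, z.2) + G (z.1, -z.2)
      + (G (-z.1, z.2) + G (-z.1, -z.2))) := by
  have hne : ∀ᵐ x : ℝ, x ≠ 0 := by simp [ae_iff]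
  have hae : (fun x : ℝ => -x) ⁻¹' Set.Ioi 0 =ᵐ[volume] (Set.Ioi (0 : ℝ))ᶜ := by
    filter_upwards [hne] with x hx
    apply propext
    change -x ∈ Set.Ioi (0 : ℝ) ↔ x ∉ Set.Ioi (0 : ℝ)
    simp only [Set.mem_Ioi, not_lt, Left.neg_pos_iff]
    exact ⟨le_of_lt, fun h => lt_of_le_of_ne h hx⟩
  set e : ℝ ≃ᵐ ℝ := MeasurableEquiv.neg ℝ
  have hmp : MeasurePreserving (fun x : ℝ => -x) volume volume := Measure.measurePreserving_neg _
  set μ : Measure (ℝ × ℝ) := (volume.restrict (Set.Ioi 0)).prod volume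
  have hH : (volume : Measure (ℝ × ℝ)).restrict (Set.Ioi 0 ×ˢ Set.univ) = μ := by
    rw [Measure.volume_eq_prod, ← Measure.prod_restrict, Measure.restrict_univ]
  have hQ : μ.restrict (Set.univ ×ˢ Set.Ioi 0)
      = (volume : Measure (ℝ × ℝ)).restrict (Set.Ioi 0 ×ˢ Set.Ioi 0) := by
    rw [← Measure.prod_restrict, Measure.restrict_univ, Measure.volume_eq_prod,
      ← Measure.prod_restrict]
  have s1 : MeasurePreserving (fun z : ℝ × ℝ => (-z.1, z.2)) volume volume :=
    hmp.prod (MeasurePreserving.id volume)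
  have s1' : MeasurableEmbedding (fun z : ℝ × ℝ => (-z.1, z.2)) :=
    (e.prodCongr (MeasurableEquiv.refl ℝ)).measurableEmbedding
  have s2 : MeasurePreserving (fun z : ℝ × ℝ => (z.1, -z.2)) μ μ :=
    (MeasurePreserving.id _).prod hmp
  have s2' : MeasurableEmbedding (fun z : ℝ × ℝ => (z.1, -z.2)) :=
    ((MeasurableEquiv.refl ℝ).prodCongr e).measurableEmbedding
  have a1 : (fun z : ℝ × ℝ => (-z.1, z.2)) ⁻¹' (Set.Ioi 0 ×ˢ Set.univ) =ᵐ[volume]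
      (Set.Ioi 0 ×ˢ Set.univ)ᶜ := by
    have := (Measure.quasiMeasurePreserving_fst (μ := (volume : Measure ℝ))
      (ν := (volume : Measure ℝ))).preimage_ae_eq hae
    rw [Set.prod_univ]
    exact this
  have a2 : (fun z : ℝ × ℝ => (z.1, -z.2)) ⁻¹' (Set.univ ×ˢ Set.Ioi 0) =ᵐ[μ]
      (Set.univ ×ˢ Set.Ioi 0)ᶜ := by
    have := (Measure.quasiMeasurePreserving_snd (μ := (volume : Measure ℝ).restrict (Set.Ioi 0))
      (ν := (volume : Measure ℝ))).preimage_ae_eq hae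
    rw [Set.univ_prod]
    exact this
  have hG1 : Integrable (fun z : ℝ × ℝ => G (-z.1, z.2)) := (s1.integrable_comp_emb s1').2 hG
  have hGμ : Integrable G μ := hH ▸ hG.integrableOn
  have hG1μ : Integrable (fun z : ℝ × ℝ => G (-z.1, z.2)) μ := hH ▸ hG1.integrableOn
  have hG2μ : Integrable (fun z : ℝ × ℝ => G (z.1, -z.2)) μ := (s2.integrable_comp_emb s2').2 hGμ
  have hG3μ : Integrable (fun z : ℝ × ℝ => G (-z.1, -z.2)) μ :=
    (s2.integrable_comp_emb s2').2 hG1μ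
  have hq : ∀ {g : ℝ × ℝ → ℝ}, Integrable g μ →
      Integrable g ((volume : Measure (ℝ × ℝ)).restrict (Set.Ioi 0 ×ˢ Set.Ioi 0)) :=
    fun hg => hQ ▸ hg.integrableOn
  rw [integral_eq_add_integral_comp s1 s1' (fun z => by simp)
    (measurableSet_Ioi.prod MeasurableSet.univ) a1 hG, hH,
    integral_eq_add_integral_comp s2 s2' (fun z => by simp)
    (MeasurableSet.univ.prod measurableSet_Ioi) a2 hGμ,
    integral_eq_add_integral_comp s2 s2' (fun z => by simp)
    (MeasurableSet.univ.prod measurableSet_Ioi) a2 hG1μ, hQ,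
    integral_add (f := fun z : ℝ × ℝ => G (z.1, z.2) + G (z.1, -z.2))
      (g := fun z : ℝ × ℝ => G (-z.1, z.2) + G (-z.1, -z.2))
      ((hq hGμ).add (hq hG2μ)) ((hq hG1μ).add (hq hG3μ)),
    integral_add (hq hGμ) (hq hG2μ), integral_add (hq hG1μ) (hq hG3μ)]

theorem continuous_gradient {φ : Plane → ℝ} (hφ : ContDiff ℝ ∞ φ) : Continuous (gradient φ) :=
  (InnerProductSpace.toDual ℝ Plane).symm.continuous.comp (hφ.continuous_fderiv (by simp))

theorem gradient_eq_zero {φ : Plane → ℝ} {z : Plane} (hz : z ∉ tsupport φ) : gradient φ z = 0 := by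
  have : fderiv ℝ φ z = 0 := by
    by_contra h
    exact hz (support_fderiv_subset ℝ h)
  simp [gradient, this]

theorem exists_norm_gradient_le {φ : Plane → ℝ} (hφ : ContDiff ℝ ∞ φ) (hc : HasCompactSupport φ) :
    ∃ M, ∀ z, ‖gradient φ z‖ ≤ M := by
  refine HasCompactSupport.exists_bound_of_continuous ?_ (continuous_gradient hφ)
  refine hc.mono' fun z hz => ?_
  by_contra h
  exact hz (gradient_eq_zero h)

theorem integrable_inner_gradient {j : Plane → Plane} {φ : Plane → ℝ} (hφ : ContDiff ℝ ∞ φ)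
    (hc : HasCompactSupport φ) (hj : IntegrableOn j (tsupport φ)) :
    Integrable fun z => inner ℝ (j z) (gradient φ z) := by
  obtain ⟨M, hM⟩ := exists_norm_gradient_le hφ hc
  have h : IntegrableOn (fun z => inner ℝ (j z) (gradient φ z)) (tsupport φ) := by
    refine Integrable.mono' (hj.norm.mul_const M)
      (hj.aestronglyMeasurable.inner (continuous_gradient hφ).aestronglyMeasurable)
      (.of_forall fun z => (norm_inner_le_norm _ _).trans ?_)
    exact mul_le_mul_of_nonneg_left (hM z) (norm_nonneg _)
  rw [← integrable_indicator_iff (isClosed_tsupport φ).measurableSet] at h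
  refine (integrable_congr (.of_forall fun z => ?_)).1 h
  by_cases hz : z ∈ tsupport φ
  · rw [Set.indicator_of_mem hz]
  · rw [Set.indicator_of_notMem hz, gradient_eq_zero hz, inner_zero_right]

/-- The signs that the kernel acquires under reflection are the chain-rule factors of the reflected
test function, so all four quadrants reduce to `integral_ker_quadrant`. -/
theorem inner_kernel_reflect {ρ : ℝ} (φ : Plane → ℝ) {s t x y : ℝ} (hs : |s| = 1) (ht : |t| = 1)
    (hx : 0 < x) (hy : 0 < y) :
    inner ℝ (kernel ρ !₂[s * x, t * y]) (gradient φ !₂[s * x, t * y])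
      = (Set.Ioo 0 ρ ×ˢ Set.Ioo 0 (1 / 2 : ℝ)).indicator (fun z : ℝ × ℝ =>
        ker₁ ρ z.1 z.2 * (s * pd 0 φ !₂[s * z.1, t * z.2])
          + ker₂ ρ z.1 z.2 * (t * pd 1 φ !₂[s * z.1, t * z.2])) (x, y) := by
  have e1 : |s * x| = x := by rw [abs_mul, hs, one_mul, abs_of_pos hx]
  have e2 : |t * y| = y := by rw [abs_mul, ht, one_mul, abs_of_pos hy]
  rw [inner_gradient_eq]
  by_cases h : x < ρ ∧ y < 1 / 2
  · have hm : (x, y) ∈ Set.Ioo 0 ρ ×ˢ Set.Ioo 0 (1 / 2 : ℝ) := ⟨⟨hx, h.1⟩, hy, h.2⟩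
    rw [Set.indicator_of_mem hm, kernel,
      if_pos (by simpa [e1, e2] using h)]
    simp only [Matrix.cons_val_zero, Matrix.cons_val_one, e1, e2]
    rw [mul_div_cancel_right₀ _ hx.ne', mul_div_cancel_right₀ _ hy.ne']
    ring
  · rw [Set.indicator_of_notMem (fun h' => h ⟨h'.1.2, h'.2.2⟩), kernel_eq_zero
      (by simpa [e1, e2] using h)]
    simp

theorem integral_ker_reflect {ρ : ℝ} (hρ : 0 < ρ) {φ : Plane → ℝ} (hφ : ContDiff ℝ ∞ φ) (s t : ℝ) :
    ∫ z in Set.Ioc 0 ρ ×ˢ Set.Ioc 0 (1 / 2 : ℝ),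
        (ker₁ ρ z.1 z.2 * (s * pd 0 φ !₂[s * z.1, t * z.2])
          + ker₂ ρ z.1 z.2 * (t * pd 1 φ !₂[s * z.1, t * z.2]))
      = Real.pi / 2 * φ 0 - Real.pi * ∫ y in (0 : ℝ)..(1 / 2), φ !₂[0, t * y] := by
  have hpt : Continuous fun z : ℝ × ℝ => (!₂[s * z.1, t * z.2] : Plane) := by fun_prop
  have c0 := (ContDiff.pd hφ 0).continuous.comp hpt
  have c1 := (ContDiff.pd hφ 1).continuous.comp hpt
  have c2 := (ContDiff.pd (ContDiff.pd hφ 0) 1).continuous.comp hpt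
  have e0 : (!₂[0, 0] : Plane) = 0 := by ext i; fin_cases i <;> simp
  have := integral_ker_quadrant hρ (f := fun x y => φ !₂[s * x, t * y])
    (fx := fun x y => s * pd 0 φ !₂[s * x, t * y]) (fy := fun x y => t * pd 1 φ !₂[s * x, t * y])
    (fxy := fun x y => s * (t * pd 1 (pd 0 φ) !₂[s * x, t * y]))
    (continuous_const.mul c0) (continuous_const.mul c1)
    (continuous_const.mul (continuous_const.mul c2))
    (fun y => hasDerivAt_snd hφ t _ y)
    (fun x y => (hasDerivAt_snd (ContDiff.pd hφ 0) t _ y).const_mul s)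
    (fun x y => by
      refine ((hasDerivAt_fst (ContDiff.pd hφ 1) s x _).const_mul t).congr_deriv ?_
      rw [pd_comm hφ]; ring)
  simpa [e0] using this

/-- The divergence of the kernel in the sense of distributions: a charge at the origin, and
its opposite on a vertical segment. -/
theorem integral_inner_kernel {ρ : ℝ} (hρ : 0 < ρ) (hρ' : ρ ≤ 1 / 2) {φ : Plane → ℝ}
    (hφ : ContDiff ℝ ∞ φ) (hc : HasCompactSupport φ) :
    ∫ z, inner ℝ (kernel ρ z) (gradient φ z)
      = 2 * Real.pi * (φ 0 - ∫ y in (-(1 / 2) : ℝ)..(1 / 2), φ !₂[0, y]) := by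
  have hG := integrable_inner_gradient hφ hc (integrable_kernel hρ hρ').integrableOn
  set F : ℝ → ℝ → ℝ × ℝ → ℝ := fun s t z =>
    ker₁ ρ z.1 z.2 * (s * pd 0 φ !₂[s * z.1, t * z.2])
      + ker₂ ρ z.1 z.2 * (t * pd 1 φ !₂[s * z.1, t * z.2]) with hF
  have hFi : ∀ s t, IntegrableOn (F s t) (Set.Ioc 0 ρ ×ˢ Set.Ioc 0 (1 / 2 : ℝ)) := fun s t => by
    have hpt : Continuous fun z : ℝ × ℝ => (!₂[s * z.1, t * z.2] : Plane) := by fun_prop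
    have c0 := (ContDiff.pd hφ 0).continuous.comp hpt
    have c1 := (ContDiff.pd hφ 1).continuous.comp hpt
    exact (integrableOn_mul_of_continuous (integrableOn_ker₁ hρ) (continuous_const.mul c0)).add
      (integrableOn_mul_of_continuous (integrableOn_ker₂ hρ) (continuous_const.mul c1))
  rw [integral_plane, integral_fold (Integrable.comp_toPlane hG)]
  have e : ∀ z ∈ Set.Ioi (0 : ℝ) ×ˢ Set.Ioi (0 : ℝ),
      (inner ℝ (kernel ρ !₂[z.1, z.2]) (gradient φ !₂[z.1, z.2])
        + inner ℝ (kernel ρ !₂[z.1, -z.2]) (gradient φ !₂[z.1, -z.2])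
        + (inner ℝ (kernel ρ !₂[-z.1, z.2]) (gradient φ !₂[-z.1, z.2])
        + inner ℝ (kernel ρ !₂[-z.1, -z.2]) (gradient φ !₂[-z.1, -z.2])))
      = (Set.Ioo 0 ρ ×ˢ Set.Ioo 0 (1 / 2 : ℝ)).indicator
        (fun z => (F 1 1 z + F 1 (-1) z) + (F (-1) 1 z + F (-1) (-1) z)) z := by
    rintro ⟨x, y⟩ ⟨hx, hy⟩
    have h := fun s t hs ht => inner_kernel_reflect (ρ := ρ) φ (s := s) (t := t) hs ht hx hy
    have h1 := h 1 1 (by simp) (by simp)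
    have h2 := h 1 (-1) (by simp) (by simp)
    have h3 := h (-1) 1 (by simp) (by simp)
    have h4 := h (-1) (-1) (by simp) (by simp)
    rw [one_mul, one_mul] at h1
    rw [one_mul, neg_one_mul] at h2
    rw [one_mul, neg_one_mul] at h3
    rw [neg_one_mul, neg_one_mul] at h4
    simp only
    rw [h1, h2, h3, h4]
    by_cases hm : (x, y) ∈ Set.Ioo 0 ρ ×ˢ Set.Ioo 0 (1 / 2 : ℝ)
    · simp only [Set.indicator_of_mem hm, hF]
    · simp only [Set.indicator_of_notMem hm, add_zero]
  rw [setIntegral_congr_fun (measurableSet_Ioi.prod measurableSet_Ioi) e,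
    setIntegral_indicator (measurableSet_Ioo.prod measurableSet_Ioo),
    Set.inter_eq_right.2 (Set.prod_mono Set.Ioo_subset_Ioi_self Set.Ioo_subset_Ioi_self),
    Measure.volume_eq_prod, setIntegral_congr_set
      (Measure.set_prod_ae_eq Ioo_ae_eq_Ioc Ioo_ae_eq_Ioc), ← Measure.volume_eq_prod,
    integral_add (f := fun z => F 1 1 z + F 1 (-1) z) (g := fun z => F (-1) 1 z + F (-1) (-1) z)
      ((hFi _ _).add (hFi _ _)) ((hFi _ _).add (hFi _ _)),
    integral_add (hFi _ _) (hFi _ _), integral_add (hFi _ _) (hFi _ _)]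
  simp only [hF]
  rw [integral_ker_reflect hρ hφ, integral_ker_reflect hρ hφ, integral_ker_reflect hρ hφ,
    integral_ker_reflect hρ hφ]
  have hcont : Continuous fun y : ℝ => φ !₂[0, y] := hφ.continuous.comp (by fun_prop)
  have hsplit : ∫ y in (-(1 / 2) : ℝ)..(1 / 2), φ !₂[0, y]
      = (∫ y in (0 : ℝ)..(1 / 2), φ !₂[0, -1 * y]) + ∫ y in (0 : ℝ)..(1 / 2), φ !₂[0, 1 * y] := by
    rw [← intervalIntegral.integral_add_adjacent_intervals
      (hcont.intervalIntegrable (-(1 / 2)) 0) (hcont.intervalIntegrable 0 (1 / 2))]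
    simp only [neg_one_mul, one_mul]
    rw [intervalIntegral.integral_comp_neg (fun y => φ !₂[0, y])]
    simp
  rw [hsplit]
  ring

/-! ### The horizontal field -/

/-- On `[-K, K]` the counting function is a constant plus one Heaviside step per point of the
window. The constant integrates to zero against `g'`, and the step at `a` gives `-g a`. -/
theorem integral_counting_mul_deriv {Λ₁ : Set ℝ} (hfin : ∀ a b, (Λ₁ ∩ Set.Icc a b).Finite)
    {K : ℝ} {A : Finset ℝ} (hA : ∀ a, a ∈ A ↔ a ∈ Λ₁ ∧ a ∈ Set.Ioc (-K) K) {g : ℝ → ℝ}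
    (hg : ContDiff ℝ 1 g) (h0 : ∀ x, K ≤ |x| → g x = 0) :
    ∫ x, counting Λ₁ x * deriv g x = -∑ a ∈ A, g a := by
  have hgc : HasCompactSupport g := HasCompactSupport.intro (isCompact_Icc (a := -K) (b := K))
    fun x hx => h0 x <| by
      by_contra h
      exact hx (abs_le.1 (not_le.1 h).le)
  have hd0 : ∀ x, K < |x| → deriv g x = 0 := fun x hx => by
    have : g =ᶠ[𝓝 x] fun _ => 0 := by
      filter_upwards [(continuous_abs.tendsto x).eventually (lt_mem_nhds hx)] with y hy
      exact h0 y (le_of_lt hy)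
    rw [this.deriv_eq, deriv_const]
  have hdi : Integrable (deriv g) :=
    (hg.continuous_deriv le_rfl).integrable_of_hasCompactSupport hgc.deriv
  have hgi : Integrable g := hg.continuous.integrable_of_hasCompactSupport hgc
  have hpt : ∀ x, counting Λ₁ x * deriv g x = counting Λ₁ (-K) * deriv g x
      + ∑ a ∈ A, (Set.Ici a).indicator (deriv g) x := fun x => by
    rcases lt_or_ge K |x| with hx | hx
    · have : ∀ a, (Set.Ici a).indicator (deriv g) x = 0 := fun a => by
        by_cases h : x ∈ Set.Ici a
        · rw [Set.indicator_of_mem h, hd0 x hx]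
        · rw [Set.indicator_of_notMem h]
      simp [hd0 x hx, this]
    · rw [abs_le] at hx
      have h1 := counting_sub hfin hx.1
      have h2 : Λ₁ ∩ Set.Ioc (-K) x = ↑(A.filter (· ≤ x)) := by
        ext a
        simp only [Set.mem_inter_iff, Set.mem_Ioc, Finset.coe_filter, hA, Set.mem_ofPred_eq]
        constructor
        · rintro ⟨h, h', h''⟩; exact ⟨⟨h, h', h''.trans hx.2⟩, h''⟩
        · rintro ⟨⟨h, h', -⟩, h''⟩; exact ⟨h, h', h''⟩
      rw [h2, Set.ncard_coe_finset] at h1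
      have h3 : ∑ a ∈ A, (Set.Ici a).indicator (deriv g) x = (A.filter (· ≤ x)).card * deriv g x := by
        rw [← nsmul_eq_mul, ← Finset.sum_const, Finset.sum_filter]
        refine Finset.sum_congr rfl fun a _ => ?_
        simp [Set.indicator_apply]
      rw [h3, ← h1]; ring
  simp_rw [hpt]
  rw [integral_add (hdi.const_mul _)
    (integrable_finsetSum _ fun a _ => hdi.indicator measurableSet_Ici), integral_const_mul,
    integral_eq_zero_of_hasDerivAt_of_integrable
      (fun x => (hg.differentiable one_ne_zero x).hasDerivAt) hdi hgi, mul_zero, zero_add,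
    integral_finsetSum _ fun a _ => hdi.indicator measurableSet_Ici, ← Finset.sum_neg_distrib]
  refine Finset.sum_congr rfl fun a _ => ?_
  rw [integral_indicator measurableSet_Ici, integral_Ici_eq_integral_Ioi,
    hgc.integral_Ioi_deriv_eq hg]

theorem integral_id_mul_deriv {g : ℝ → ℝ} (hg : ContDiff ℝ 1 g) (hgc : HasCompactSupport g) :
    ∫ x, x * deriv g x = -∫ x, g x := by
  have h := integral_mul_deriv_eq_deriv_mul_of_integrable (u := fun x : ℝ => x)
    (u' := fun _ => 1) (v := g) (v' := deriv g) (fun x _ => hasDerivAt_id x)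
    (fun x _ => (hg.differentiable one_ne_zero x).hasDerivAt)
    ((continuous_id.mul (hg.continuous_deriv le_rfl)).integrable_of_hasCompactSupport
      hgc.deriv.mul_left)
    ((continuous_const.mul hg.continuous).integrable_of_hasCompactSupport hgc.mul_left)
    ((continuous_id.mul hg.continuous).integrable_of_hasCompactSupport hgc.mul_left)
  simpa using h

/-- The field `-2π (N(x) - x)`, where `N` counts the points of `Λ₁`. -/
def flow (Λ₁ : Set ℝ) (x : ℝ) : ℝ := -(2 * Real.pi) * (counting Λ₁ x - x)

theorem measurable_flow {Λ₁ : Set ℝ} (hfin : ∀ a b, (Λ₁ ∩ Set.Icc a b).Finite) :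
    Measurable (flow Λ₁) := by
  have := (monotone_counting hfin).measurable
  unfold flow
  fun_prop

/-- The function vanishes where a coordinate is at least `K` in absolute value. -/
def SupportedIn (φ : Plane → ℝ) (K : ℝ) : Prop := ∀ z : Plane, K ≤ |z 0| ∨ K ≤ |z 1| → φ z = 0

theorem exists_supportedIn {φ : Plane → ℝ} (hc : HasCompactSupport φ) :
    ∃ M : ℝ, tsupport φ ⊆ Metric.closedBall 0 M ∧ ∀ K, M < K → SupportedIn φ K := by
  obtain ⟨M, hM⟩ := hc.isBounded.subset_closedBall 0
  refine ⟨M, hM, fun K hK z hz => ?_⟩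
  by_contra h
  have h1 := mem_closedBall_zero_iff.1 (hM (subset_tsupport φ h))
  have h2 := PiLp.norm_apply_le z 0
  have h3 := PiLp.norm_apply_le z 1
  rw [Real.norm_eq_abs] at h2 h3
  rcases hz with hz | hz <;> linarith

theorem contDiff_slice_fst {φ : Plane → ℝ} (hφ : ContDiff ℝ ∞ φ) (y : ℝ) :
    ContDiff ℝ ∞ fun x => φ !₂[x, y] := by
  refine hφ.comp ?_
  rw [contDiff_euclidean]
  intro i
  fin_cases i
  · exact contDiff_id
  · simpa using contDiff_const

theorem hasCompactSupport_fst {φ : Plane → ℝ} {K : ℝ} (h : SupportedIn φ K) (y : ℝ) :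
    HasCompactSupport fun x => φ !₂[x, y] :=
  HasCompactSupport.intro (isCompact_Icc (a := -K) (b := K)) fun x hx => h _ <| .inl <| by
    by_contra hlt
    exact hx (abs_le.1 (not_le.1 hlt).le)

theorem hasCompactSupport_snd {φ : Plane → ℝ} {K : ℝ} (h : SupportedIn φ K) (x : ℝ) :
    HasCompactSupport fun y => φ !₂[x, y] :=
  HasCompactSupport.intro (isCompact_Icc (a := -K) (b := K)) fun y hy => h _ <| .inr <| by
    by_contra hlt
    exact hy (abs_le.1 (not_le.1 hlt).le)

theorem integrable_plane {φ : Plane → ℝ} (hφ : ContDiff ℝ ∞ φ) (hc : HasCompactSupport φ) :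
    Integrable φ := hφ.continuous.integrable_of_hasCompactSupport hc

theorem integral_flow {Λ₁ : Set ℝ} (hfin : ∀ a b, (Λ₁ ∩ Set.Icc a b).Finite)
    {K : ℝ} {A : Finset ℝ} (hA : ∀ a, a ∈ A ↔ a ∈ Λ₁ ∧ a ∈ Set.Ioc (-K) K)
    {φ : Plane → ℝ} (hφ : ContDiff ℝ ∞ φ) (hc : HasCompactSupport φ) (hK : SupportedIn φ K)
    (hint : Integrable fun z : Plane => flow Λ₁ (z 0) * pd 0 φ z) :
    ∫ z : Plane, flow Λ₁ (z 0) * pd 0 φ z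
      = 2 * Real.pi * (∑ a ∈ A, ∫ y, φ !₂[a, y]) - 2 * Real.pi * ∫ z, φ z := by
  have hφi := Integrable.comp_toPlane (integrable_plane hφ hc)
  have hint' := Integrable.comp_toPlane hint
  have hcont : ∀ x, Continuous fun y => φ !₂[x, y] := fun x => hφ.continuous.comp (by fun_prop)
  rw [integral_plane, integral_plane φ, Measure.volume_eq_prod, integral_prod_symm _ hφi,
    integral_prod_symm _ hint', ← integral_finsetSum _ fun a _ =>
      (hcont a).integrable_of_hasCompactSupport (hasCompactSupport_snd hK a),
    ← integral_const_mul, ← integral_const_mul, ← integral_sub]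
  · congr 1 with y
    have hg : ContDiff ℝ 1 fun x => φ !₂[x, y] := (contDiff_slice_fst hφ y).of_le (by simp)
    have hgc := hasCompactSupport_fst hK y
    have hd : ∀ x, pd 0 φ !₂[x, y] = deriv (fun x => φ !₂[x, y]) x := fun x => by
      have := (hasDerivAt_fst hφ 1 x y).deriv
      simpa using this.symm
    have h1 := integral_counting_mul_deriv hfin hA hg fun x hx => hK _ (.inl (by simpa using hx))
    have h2 := integral_id_mul_deriv hg hgc
    have i2 : Integrable fun x => x * deriv (fun x => φ !₂[x, y]) x :=
      (continuous_id.mul (hg.continuous_deriv le_rfl)).integrable_of_hasCompactSupport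
        hgc.deriv.mul_left
    have i1 : Integrable fun x => counting Λ₁ x * deriv (fun x => φ !₂[x, y]) x := by
      have i0 : Integrable (deriv fun x => φ !₂[x, y]) :=
        (hg.continuous_deriv le_rfl).integrable_of_hasCompactSupport hgc.deriv
      obtain ⟨B, hB⟩ : ∃ B, ∀ x ∈ Set.Icc (-K) K, |counting Λ₁ x| ≤ B := by
        refine ⟨max |counting Λ₁ (-K)| |counting Λ₁ K|, fun x hx => ?_⟩
        exact abs_le_max_abs_abs (monotone_counting hfin hx.1) (monotone_counting hfin hx.2)
      refine Integrable.mono' (i0.norm.const_mul B)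
        ((monotone_counting hfin).measurable.aestronglyMeasurable.mul i0.aestronglyMeasurable)
        (.of_forall fun x => ?_)
      rw [norm_mul]
      by_cases hx : x ∈ Set.Icc (-K) K
      · exact mul_le_mul_of_nonneg_right (hB x hx) (norm_nonneg _)
      · have : deriv (fun x => φ !₂[x, y]) x = 0 := by
          have hopen : (Set.Icc (-K) K)ᶜ ∈ 𝓝 x := isClosed_Icc.isOpen_compl.mem_nhds hx
          have : (fun x => φ !₂[x, y]) =ᶠ[𝓝 x] fun _ => 0 := by
            filter_upwards [hopen] with w hw
            refine hK _ (.inl ?_)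
            by_contra hlt
            exact hw (abs_le.1 (not_le.1 (by simpa using hlt)).le)
          rw [this.deriv_eq, deriv_const]
        simp [this]
    have e : ∀ x, flow Λ₁ x * deriv (fun x => φ !₂[x, y]) x
        = -(2 * Real.pi) * (counting Λ₁ x * deriv (fun x => φ !₂[x, y]) x
          - x * deriv (fun x => φ !₂[x, y]) x) := fun x => by unfold flow; ring
    simp only [hd, Matrix.cons_val_zero, e]
    rw [integral_const_mul, integral_sub i1 i2, h1, h2]
    ring
  · exact (integrable_finsetSum _ fun a _ =>
      (hcont a).integrable_of_hasCompactSupport (hasCompactSupport_snd hK a)).const_mul _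
  · exact hφi.integral_prod_right.const_mul _

/-! ### Sums over the points of a window -/

/-- The rows `-K, …, K` are indexed by `i = n + K`, so that the segments of a column can later be
telescoped over a range of natural numbers. -/
theorem finsum_prodInt_eq {M : Type*} [AddCommMonoid M] {Λ₁ : Set ℝ} {K : ℕ} {A : Finset ℝ}
    (hA : ∀ a, a ∈ A ↔ a ∈ Λ₁ ∧ a ∈ Set.Ioc (-K : ℝ) K) {g : Plane → M}
    (hg : ∀ p : Plane, g p ≠ 0 → |p 0| < (K : ℝ) ∧ |p 1| < (K : ℝ) + 1) :
    ∑ᶠ p ∈ prodInt Λ₁, g p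
      = ∑ a ∈ A, ∑ i ∈ Finset.range (2 * K + 1), g !₂[a, (i : ℝ) - K] := by
  classical
  set e : ℝ × ℕ → Plane := fun q => !₂[q.1, (q.2 : ℝ) - K] with he
  have hinj : Function.Injective e := by
    rintro ⟨a, n⟩ ⟨b, m⟩ hab
    have h0 := congrFun (congrArg WithLp.ofLp hab) 0
    have h1 := congrFun (congrArg WithLp.ofLp hab) 1
    simp [he] at h0 h1
    simp [h0, h1]
  rw [finsum_mem_eq_sum_of_subset (t := (A ×ˢ Finset.range (2 * K + 1)).image e),
    Finset.sum_image hinj.injOn, Finset.sum_product]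
  · rintro p ⟨⟨hp, n, hn⟩, hgp⟩
    obtain ⟨h0, h1⟩ := hg p hgp
    rw [hn, abs_lt] at h1
    rw [abs_lt] at h0
    have h2 : -(K : ℤ) - 1 < n := by have := h1.1; exact_mod_cast (by linarith : -(K : ℝ) - 1 < n)
    have h3 : n < (K : ℤ) + 1 := by
      have : (n : ℝ) < ((K + 1 : ℤ) : ℝ) := by push_cast; exact h1.2
      exact Int.cast_lt.1 this
    obtain ⟨i, hi⟩ : ∃ i : ℕ, n + K = i := ⟨(n + K).toNat, by omega⟩
    rw [Finset.mem_coe, Finset.mem_image]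
    refine ⟨(p 0, i), Finset.mem_product.2 ⟨(hA _).2 ⟨hp, h0.1, h0.2.le⟩,
      Finset.mem_range.2 (by simp only; omega)⟩, ?_⟩
    have hi' : (n : ℝ) + K = i := by exact_mod_cast hi
    ext k
    fin_cases k
    · simp [he]
    · simp [he, hn, ← hi']
  · intro p hp
    rw [Finset.mem_coe, Finset.mem_image] at hp
    obtain ⟨⟨a, i⟩, hq, rfl⟩ := hp
    have := (hA a).1 (Finset.mem_product.1 hq).1
    exact ⟨by simpa [he] using this.1, (i : ℤ) - K, by simp [he]⟩

/-- The unit segments centered at `-K, …, K` tile `[-K - 1/2, K + 1/2]`, which contains the support.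
This is where the spacing of `ℤ` matches the height of the kernel. -/
theorem sum_integral_segments {g : ℝ → ℝ} (hg : Continuous g) {K : ℕ}
    (h0 : ∀ y, (K : ℝ) ≤ |y| → g y = 0) :
    ∑ i ∈ Finset.range (2 * K + 1), ∫ y in (-(1 / 2) : ℝ)..(1 / 2), g ((i : ℝ) - K + y)
      = ∫ y, g y := by
  have h := intervalIntegral.sum_integral_adjacent_intervals (μ := volume) (f := g)
    (a := fun k : ℕ => (k : ℝ) - K - 1 / 2) (n := 2 * K + 1)
    (fun k _ => hg.intervalIntegrable _ _)
  have e : ∀ i : ℕ, ∫ y in (-(1 / 2) : ℝ)..(1 / 2), g ((i : ℝ) - K + y)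
      = ∫ y in ((i : ℝ) - K - 1 / 2)..(((i + 1 : ℕ) : ℝ) - K - 1 / 2), g y := fun i => by
    rw [intervalIntegral.integral_comp_add_left]
    congr 1
    push_cast
    ring
  rw [Finset.sum_congr rfl fun i _ => e i, h,
    intervalIntegral.integral_eq_integral_of_support_subset]
  intro y hy
  have hy' : |y| < K := by
    by_contra hlt
    exact hy (h0 y (not_lt.1 hlt))
  rw [abs_lt] at hy'
  constructor <;> (push_cast; linarith)

/-! ### The field -/

/-- The field used as a competitor: the kernels centered at the points of the configuration, and a
horizontal flow. -/
def field (Λ₁ : Set ℝ) (ρ : ℝ) (x : Plane) : Plane :=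
  (∑ᶠ p ∈ prodInt Λ₁, kernel ρ (x - p)) + !₂[flow Λ₁ (x 0), 0]

theorem field_eq_sum {Λ₁ : Set ℝ} {ρ : ℝ} (hρ' : ρ ≤ 1 / 2) {K : ℕ} {A : Finset ℝ}
    (hA : ∀ a, a ∈ A ↔ a ∈ Λ₁ ∧ a ∈ Set.Ioc (-K : ℝ) K) {M : ℝ} (hM : M + 1 ≤ K) {x : Plane}
    (hx : ‖x‖ ≤ M) :
    field Λ₁ ρ x = ∑ a ∈ A, ∑ i ∈ Finset.range (2 * K + 1), kernel ρ (x - !₂[a, (i : ℝ) - K])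
      + !₂[flow Λ₁ (x 0), 0] := by
  rw [field, finsum_prodInt_eq hA]
  intro p hp
  have hb : |(x - p) 0| < ρ ∧ |(x - p) 1| < 1 / 2 := by
    by_contra h
    exact hp (kernel_eq_zero h)
  have h0 := (Real.norm_eq_abs _ ▸ PiLp.norm_apply_le x 0).trans hx
  have h1 := (Real.norm_eq_abs _ ▸ PiLp.norm_apply_le x 1).trans hx
  simp only [PiLp.sub_apply] at hb
  rw [abs_lt, abs_lt] at hb
  rw [abs_le] at h0 h1
  constructor <;> rw [abs_lt] <;> constructor <;> linarith [hb.1.1, hb.1.2, hb.2.1, hb.2.2]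

theorem exists_window {Λ₁ : Set ℝ} (hfin : ∀ a b, (Λ₁ ∩ Set.Icc a b).Finite) (K : ℕ) :
    ∃ A : Finset ℝ, ∀ a, a ∈ A ↔ a ∈ Λ₁ ∧ a ∈ Set.Ioc (-K : ℝ) K := by
  have h : (Λ₁ ∩ Set.Ioc (-K : ℝ) K).Finite := (hfin (-K) K).subset
    (Set.inter_subset_inter_right _ Set.Ioc_subset_Icc_self)
  exact ⟨h.toFinset, fun a => by simp⟩

theorem measurable_flow_vec {Λ₁ : Set ℝ} (hfin : ∀ a b, (Λ₁ ∩ Set.Icc a b).Finite) :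
    Measurable fun x : Plane => (!₂[flow Λ₁ (x 0), 0] : Plane) := by
  refine (WithLp.measurable_toLp 2 _).comp (measurable_pi_iff.2 fun i => ?_)
  have := measurable_flow hfin
  fin_cases i
  · simpa using (by fun_prop : Measurable fun x : Plane => flow Λ₁ (x 0))
  · simp

theorem norm_vec_fst (t : ℝ) : ‖(!₂[t, 0] : Plane)‖ = |t| := by
  rw [EuclideanSpace.norm_eq]
  simp [Real.sqrt_sq_eq_abs]

theorem integrableOn_flow_vec {Λ₁ : Set ℝ} (hfin : ∀ a b, (Λ₁ ∩ Set.Icc a b).Finite) {H : ℝ}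
    (hH : ∀ x, |flow Λ₁ x| ≤ H) {S : Set Plane} (hS : volume S ≠ ⊤) :
    IntegrableOn (fun x : Plane => (!₂[flow Λ₁ (x 0), 0] : Plane)) S :=
  Integrable.mono' (integrableOn_const (C := H) hS)
    (measurable_flow_vec hfin).aestronglyMeasurable
    (.of_forall fun x => by rw [norm_vec_fst]; exact hH _)

theorem integrableOn_field {Λ₁ : Set ℝ} (hfin : ∀ a b, (Λ₁ ∩ Set.Icc a b).Finite) {ρ : ℝ}
    (hρ : 0 < ρ) (hρ' : ρ ≤ 1 / 2) {H : ℝ} (hH : ∀ x, |flow Λ₁ x| ≤ H) (M : ℝ) :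
    IntegrableOn (field Λ₁ ρ) (Metric.closedBall 0 M) := by
  obtain ⟨K, hK⟩ := exists_nat_ge (M + 1)
  obtain ⟨A, hA⟩ := exists_window hfin K
  have h : IntegrableOn (fun x => ∑ a ∈ A, ∑ i ∈ Finset.range (2 * K + 1),
      kernel ρ (x - !₂[a, (i : ℝ) - K]) + !₂[flow Λ₁ (x 0), 0]) (Metric.closedBall 0 M) := by
    refine Integrable.add (integrable_finsetSum _ fun a _ => integrable_finsetSum _ fun i _ => ?_)
      (integrableOn_flow_vec hfin hH measure_closedBall_lt_top.ne)
    exact ((integrable_kernel hρ hρ').comp_sub_right _).integrableOn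
  exact h.congr_fun (fun x hx => (field_eq_sum hρ' hA hK (mem_closedBall_zero_iff.1 hx)).symm)
    measurableSet_closedBall

theorem locallyIntegrable_field {Λ₁ : Set ℝ} (hfin : ∀ a b, (Λ₁ ∩ Set.Icc a b).Finite) {ρ : ℝ}
    (hρ : 0 < ρ) (hρ' : ρ ≤ 1 / 2) {H : ℝ} (hH : ∀ x, |flow Λ₁ x| ≤ H) :
    LocallyIntegrable (field Λ₁ ρ) := by
  rw [locallyIntegrable_iff]
  intro S hS
  obtain ⟨M, hM⟩ := hS.isBounded.subset_closedBall 0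
  exact (integrableOn_field hfin hρ hρ' hH M).mono_set hM

theorem integral_inner_kernel_sub {ρ : ℝ} (hρ : 0 < ρ) (hρ' : ρ ≤ 1 / 2) {φ : Plane → ℝ}
    (hφ : ContDiff ℝ ∞ φ) (hc : HasCompactSupport φ) (a b : ℝ) :
    ∫ z, inner ℝ (kernel ρ (z - !₂[a, b])) (gradient φ z)
      = 2 * Real.pi * (φ !₂[a, b] - ∫ y in (-(1 / 2) : ℝ)..(1 / 2), φ !₂[a, b + y]) := by
  set p : Plane := !₂[a, b] with hp
  have hc' : HasCompactSupport fun z => φ (z + p) :=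
    hc.comp_homeomorph (Homeomorph.addRight p)
  have h := integral_inner_kernel hρ hρ' (φ := fun z => φ (z + p)) (hφ.comp (by fun_prop)) hc'
  have hgrad : ∀ z, gradient (fun z => φ (z + p)) z = gradient φ (z + p) := fun z => by
    simp only [gradient, fderiv_comp_add_right]
  rw [← integral_add_right_eq_self _ p]
  simp only [hgrad] at h
  simp only [add_sub_cancel_right]
  rw [h, zero_add]
  congr 3 with y
  congr 1
  ext i
  fin_cases i <;> simp [hp, add_comm]

theorem solvesDivEquation_field {Λ₁ : Set ℝ} (hfin : ∀ a b, (Λ₁ ∩ Set.Icc a b).Finite) {ρ : ℝ}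
    (hρ : 0 < ρ) (hρ' : ρ ≤ 1 / 2) {H : ℝ} (hH : ∀ x, |flow Λ₁ x| ≤ H) :
    SolvesDivEquation (prodInt Λ₁) 1 (field Λ₁ ρ) := by
  intro φ hφ hc
  obtain ⟨M, hM, hsupp⟩ := exists_supportedIn hc
  obtain ⟨K, hK⟩ := exists_nat_ge (M + 1)
  obtain ⟨A, hA⟩ := exists_window hfin K
  have hs : SupportedIn φ K := hsupp K (by linarith)
  have hcont : ∀ x, Continuous fun y => φ !₂[x, y] := fun x => hφ.continuous.comp (by fun_prop)
  have hker : ∀ a b : ℝ, Integrable fun z =>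
      inner ℝ (kernel ρ (z - !₂[a, b])) (gradient φ z) := fun a b =>
    integrable_inner_gradient hφ hc ((integrable_kernel hρ hρ').comp_sub_right _).integrableOn
  have hflow : Integrable fun z : Plane => inner ℝ (!₂[flow Λ₁ (z 0), 0] : Plane) (gradient φ z) :=
    integrable_inner_gradient hφ hc
      (integrableOn_flow_vec hfin hH hc.isCompact.measure_lt_top.ne)
  have hpt : ∀ x, inner ℝ (field Λ₁ ρ x) (gradient φ x)
      = ∑ a ∈ A, ∑ i ∈ Finset.range (2 * K + 1),
          inner ℝ (kernel ρ (x - !₂[a, (i : ℝ) - K])) (gradient φ x)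
        + inner ℝ (!₂[flow Λ₁ (x 0), 0] : Plane) (gradient φ x) := fun x => by
    by_cases hx : x ∈ tsupport φ
    · rw [field_eq_sum hρ' hA hK (mem_closedBall_zero_iff.1 (hM hx)), inner_add_left]
      simp only [sum_inner]
    · simp [gradient_eq_zero hx]
  simp_rw [hpt]
  rw [integral_add (integrable_finsetSum _ fun a _ => integrable_finsetSum _ fun i _ => hker _ _)
      hflow, integral_finsetSum _ fun a _ => integrable_finsetSum _ fun i _ => hker _ _]
  have hflow' : ∀ z : Plane, inner ℝ (!₂[flow Λ₁ (z 0), 0] : Plane) (gradient φ z)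
      = flow Λ₁ (z 0) * pd 0 φ z := fun z => by
    rw [inner_gradient_eq]; simp
  simp_rw [hflow'] at hflow ⊢
  rw [integral_flow hfin hA hφ hc hs hflow, finsum_prodInt_eq hA]
  -- A whole column exchanges its point charges for a uniform charge on the line through `a`, which
  -- the horizontal flow then cancels.
  · have hcol : ∀ a ∈ A, ∫ x, ∑ i ∈ Finset.range (2 * K + 1),
        inner ℝ (kernel ρ (x - !₂[a, (i : ℝ) - K])) (gradient φ x)
        = 2 * Real.pi * ∑ i ∈ Finset.range (2 * K + 1), φ !₂[a, (i : ℝ) - K]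
          - 2 * Real.pi * ∫ y, φ !₂[a, y] := fun a _ => by
      rw [integral_finsetSum _ fun i _ => hker _ _]
      simp_rw [integral_inner_kernel_sub hρ hρ' hφ hc]
      rw [← Finset.mul_sum, Finset.sum_sub_distrib,
        sum_integral_segments (hcont a) fun y hy => hs _ (.inr (by simpa using hy))]
      ring
    rw [Finset.sum_congr rfl hcol, Finset.sum_sub_distrib, ← Finset.mul_sum, ← Finset.mul_sum]
    ring
  · intro p hp
    by_contra h
    refine hp (hs p ?_)
    by_contra h'
    push Not at h'
    exact h ⟨h'.1, by linarith [h'.2]⟩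

/-! ### Pointwise bounds for the field -/

/-- Boxes of height one, open and centered at integer heights, meet only within a row; there the
separation `δ ≥ 2ρ` keeps them apart. -/
theorem eq_of_mem_boxes {Λ₁ : Set ℝ} {δ ρ : ℝ} (hρ : 2 * ρ ≤ δ)
    (hsep : ∀ p ∈ prodInt Λ₁, ∀ q ∈ prodInt Λ₁, p ≠ q → δ ≤ dist p q) {x p q : Plane}
    (hp : p ∈ prodInt Λ₁) (hq : q ∈ prodInt Λ₁)
    (hxp : |(x - p) 0| < ρ ∧ |(x - p) 1| < 1 / 2) (hxq : |(x - q) 0| < ρ ∧ |(x - q) 1| < 1 / 2) :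
    q = p := by
  by_contra hne
  have h := hsep q hq p hp hne
  obtain ⟨-, n, hn⟩ := hp
  obtain ⟨-, m, hm⟩ := hq
  simp only [PiLp.sub_apply, abs_lt] at hxp hxq
  rw [hn] at hxp
  rw [hm] at hxq
  have h1 : m < n + 1 := by
    exact_mod_cast (by linarith [hxp.2.1, hxp.2.2, hxq.2.1, hxq.2.2] : (m : ℝ) < n + 1)
  have h2 : n < m + 1 := by
    exact_mod_cast (by linarith [hxp.2.1, hxp.2.2, hxq.2.1, hxq.2.2] : (n : ℝ) < m + 1)
  obtain rfl : m = n := by omega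
  have h3 := norm_le_abs_add_abs (q - p)
  rw [← dist_eq_norm] at h3
  simp only [PiLp.sub_apply, hn, hm, sub_self, abs_zero, add_zero] at h3
  have h4 : |q 0 - p 0| < 2 * ρ := by
    rw [abs_lt]
    constructor <;> linarith [hxp.1.1, hxp.1.2, hxq.1.1, hxq.1.2]
  linarith

theorem norm_field_cases {Λ₁ : Set ℝ} {δ ρ : ℝ} (hρ0 : 0 < ρ) (hρ' : ρ ≤ 1 / 2) (hρ : 2 * ρ ≤ δ)
    (hsep : ∀ p ∈ prodInt Λ₁, ∀ q ∈ prodInt Λ₁, p ≠ q → δ ≤ dist p q) {H : ℝ}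
    (hH : ∀ x, |flow Λ₁ x| ≤ H) (x : Plane) :
    ‖field Λ₁ ρ x‖ ≤ 4 + 2 / ρ + H ∨
      ∃ p ∈ prodInt Λ₁, ‖x - p‖ < 1 ∧ ‖field Λ₁ ρ x‖ ≤ ‖x - p‖⁻¹ + (4 + 2 / ρ + H) := by
  have hflow : ‖(!₂[flow Λ₁ (x 0), 0] : Plane)‖ ≤ H := by rw [norm_vec_fst]; exact hH _
  by_cases h : ∃ p ∈ prodInt Λ₁, |(x - p) 0| < ρ ∧ |(x - p) 1| < 1 / 2
  · obtain ⟨p, hp, hb⟩ := h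
    refine .inr ⟨p, hp, norm_lt_one_of_mem_box hρ' hb, ?_⟩
    have e : ∑ᶠ q ∈ prodInt Λ₁, kernel ρ (x - q) = kernel ρ (x - p) := by
      rw [finsum_mem_eq_sum_of_subset (t := {p}), Finset.sum_singleton]
      · rintro q ⟨hq, hqs⟩
        rw [Finset.coe_singleton, Set.mem_singleton_iff]
        refine eq_of_mem_boxes hρ hsep hp hq hb ?_
        by_contra hq'
        exact hqs (kernel_eq_zero hq')
      · simpa using hp
    rw [field, e]
    refine (norm_add_le _ _).trans ?_
    linarith [norm_kernel_le hρ0 (x - p)]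
  · left
    have e : ∑ᶠ q ∈ prodInt Λ₁, kernel ρ (x - q) = 0 := by
      rw [finsum_mem_eq_sum_of_subset (t := ∅), Finset.sum_empty]
      · rintro q ⟨hq, hqs⟩
        exact (hqs (kernel_eq_zero fun hb => h ⟨q, hq, hb⟩)).elim
      · simp
    rw [field, e, zero_add]
    have : 0 < 2 / ρ := by positivity
    linarith

theorem memLp_field {Λ₁ : Set ℝ} (hfin : ∀ a b, (Λ₁ ∩ Set.Icc a b).Finite) {ρ : ℝ}
    (hρ : 0 < ρ) (hρ' : ρ ≤ 1 / 2) {H : ℝ} (hH : ∀ x, |flow Λ₁ x| ≤ H) {S : Set Plane}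
    (hS : IsCompact S) (hSΛ : S ⊆ (prodInt Λ₁)ᶜ) :
    MemLp (field Λ₁ ρ) 2 (volume.restrict S) := by
  have : IsFiniteMeasure (volume.restrict S) := ⟨by simpa using hS.measure_lt_top⟩
  obtain ⟨M, hM⟩ := hS.isBounded.subset_closedBall 0
  obtain ⟨K, hK⟩ := exists_nat_ge (M + 1)
  obtain ⟨A, hA⟩ := exists_window hfin K
  have h : MemLp (fun x => ∑ a ∈ A, ∑ i ∈ Finset.range (2 * K + 1),
      kernel ρ (x - !₂[a, (i : ℝ) - K]) + !₂[flow Λ₁ (x 0), 0]) 2 (volume.restrict S) := by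
    refine MemLp.add (memLp_finsetSum _ fun a ha => memLp_finsetSum _ fun i _ => ?_)
      (MemLp.of_bound (measurable_flow_vec hfin).aestronglyMeasurable H
        (.of_forall fun x => by rw [norm_vec_fst]; exact hH _))
    have hp : !₂[a, (i : ℝ) - K] ∈ Sᶜ := fun hp =>
      hSΛ hp ⟨by simpa using ((hA a).1 ha).1, (i : ℤ) - K, by simp⟩
    -- Each of the finitely many centers in the window has positive distance from the compact set,
    -- so its kernel is bounded there.
    obtain ⟨ε, hε, hball⟩ := Metric.isOpen_iff.1 hS.isClosed.isOpen_compl _ hp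
    refine MemLp.of_bound
      ((measurable_kernel ρ).comp (measurable_id.sub_const _)).aestronglyMeasurable
      (ε⁻¹ + (4 + 2 / ρ)) ?_
    refine (ae_restrict_iff' hS.isClosed.measurableSet).2 (.of_forall fun x hx => ?_)
    refine (norm_kernel_le hρ _).trans ?_
    have : ε ≤ ‖x - !₂[a, (i : ℝ) - K]‖ := by
      by_contra hlt
      exact hball (mem_ball_iff_norm.2 (not_le.1 hlt)) hx
    gcongr
  refine h.ae_eq ?_
  refine (ae_restrict_iff' hS.isClosed.measurableSet).2 (.of_forall fun x hx => ?_)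
  exact (field_eq_sum hρ' hA hK (mem_closedBall_zero_iff.1 (hM hx))).symm

theorem field_mem_fields {Λ₁ : Set ℝ} (hfin : ∀ a b, (Λ₁ ∩ Set.Icc a b).Finite) {ρ : ℝ}
    (hρ : 0 < ρ) (hρ' : ρ ≤ 1 / 2) {H : ℝ} (hH : ∀ x, |flow Λ₁ x| ≤ H) :
    field Λ₁ ρ ∈ fields (prodInt Λ₁) 1 :=
  ⟨locallyIntegrable_field hfin hρ hρ' hH, fun _ hS hSΛ => memLp_field hfin hρ hρ' hH hS hSΛ,
    solvesDivEquation_field hfin hρ hρ' hH⟩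

/-! ### Cut-off functions -/

theorem IsCutoffFamily.exists_bound {χ : ℝ → Plane → ℝ} (hχ : IsCutoffFamily χ) :
    ∃ G : ℝ, 0 ≤ G ∧ ∀ R : ℝ, 2 ≤ R →
      (∀ x y, χ R x ≤ χ R y + G * ‖x - y‖) ∧ ∀ x, χ R x ≤ 1 + G := by
  obtain ⟨G, hG⟩ := hχ.gradient_le
  have hG0 : 0 ≤ G := (norm_nonneg _).trans (hG 2 (by norm_num) 0)
  refine ⟨G, hG0, fun R hR => ?_⟩
  have hR1 : 1 < R := by linarith
  have hlip : ∀ x y, χ R x ≤ χ R y + G * ‖x - y‖ := fun x y => by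
    have hfd : ∀ z, ‖fderiv ℝ (χ R) z‖ ≤ G := fun z => by
      have := hG R hR1 z
      rwa [gradient, LinearIsometryEquiv.norm_map] at this
    have := convex_univ.norm_image_sub_le_of_norm_fderiv_le (𝕜 := ℝ)
      (fun z _ => (hχ.smooth R hR1).differentiable (by simp) z) (fun z _ => hfd z)
      (Set.mem_univ y) (Set.mem_univ x)
    linarith [(le_abs_self _).trans this]
  refine ⟨hlip, fun x => ?_⟩
  rcases lt_or_ge ‖x‖ (R - 1) with hx | hx
  · rw [hχ.eq_one R hR1 x (mem_ball_zero_iff.2 hx)]; linarith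
  rcases lt_or_ge ‖x‖ R with hx' | hx'
  · have hpos : 0 < ‖x‖ := by linarith
    -- In the transition annulus the radial projection to the sphere of radius `R` moves `x` by at
    -- most `1`, and the cut-off vanishes there; the Lipschitz bound then gives `χ ≤ G`.
    have h0 : χ R ((R / ‖x‖) • x) = 0 := by
      refine hχ.eq_zero R hR1 _ ?_
      rw [mem_ball_zero_iff, norm_smul, norm_div, norm_norm, div_mul_cancel₀ _ hpos.ne',
        Real.norm_eq_abs, abs_of_pos (by linarith)]
      exact lt_irrefl R
    have h1 : ‖x - (R / ‖x‖) • x‖ ≤ 1 := by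
      have : x - (R / ‖x‖) • x = (1 - R / ‖x‖) • x := by rw [sub_smul, one_smul]
      rw [this, norm_smul, Real.norm_eq_abs, abs_sub_comm, abs_of_nonneg, sub_mul,
        div_mul_cancel₀ _ hpos.ne']
      · linarith
      · rw [sub_nonneg, le_div_iff₀ hpos]; linarith
    have h2 := hlip x ((R / ‖x‖) • x)
    rw [h0] at h2
    nlinarith
  · rw [hχ.eq_zero R hR1 x (by simpa using hx')]; linarith

/-! ### The energy -/

/-- In polar coordinates the integral is `2π ∫ (c / r + D) dr` over `[η, 1]`: only the coefficient
of `1/r²` produces a logarithm. -/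
theorem lintegral_annulus_le (p : Plane) {η c D : ℝ} (hη : 0 < η) (hη1 : η < 1) (hc : 0 ≤ c)
    (hD : 0 ≤ D) :
    ∫⁻ x in Metric.ball p 1 \ Metric.ball p η, ENNReal.ofReal (c * (‖x - p‖⁻¹) ^ 2 + D * ‖x - p‖⁻¹)
      ≤ ENNReal.ofReal (2 * Real.pi * (-(c * Real.log η) + D)) := by
  set f : ℝ → ℝ := (Set.Ico η 1).indicator fun r => c * (r⁻¹) ^ 2 + D * r⁻¹ with hf
  have hf0 : ∀ r, 0 ≤ f r := fun r => Set.indicator_nonneg (fun r hr => by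
    have : 0 < r := hη.trans_le hr.1
    positivity) r
  have hfy : ∀ y, y ^ (Module.finrank ℝ Plane - 1) • f y
      = (Set.Ico η 1).indicator (fun y => c * y⁻¹ + D) y := fun y => by
    by_cases hy : y ∈ Set.Ico η 1
    · have : y ≠ 0 := (hη.trans_le hy.1).ne'
      rw [hf, Set.indicator_of_mem hy, Set.indicator_of_mem hy]
      simp
      field_simp
    · rw [hf, Set.indicator_of_notMem hy, Set.indicator_of_notMem hy, smul_zero]
  have hsub : Set.Ico η 1 ⊆ Set.Ioi (0 : ℝ) := fun y hy => hη.trans_le hy.1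
  have hne : ∀ y ∈ Set.uIcc η 1, y ≠ 0 := fun y hy => by
    rw [Set.uIcc_of_le hη1.le] at hy
    exact (hη.trans_le hy.1).ne'
  have hii : IntervalIntegrable (fun y => c * y⁻¹ + D) volume η 1 :=
    ((intervalIntegral.intervalIntegrable_inv hne continuousOn_id).const_mul c).add
      intervalIntegrable_const
  have hint : Integrable fun z : Plane => f ‖z‖ := by
    rw [integrable_fun_norm_addHaar]
    simp_rw [hfy]
    refine IntegrableOn.integrable_indicator ?_ measurableSet_Ico |>.integrableOn
    exact (intervalIntegrable_iff_integrableOn_Ico_of_le hη1.le).1 hii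
  have hval : ∫ z : Plane, f ‖z‖ = 2 * Real.pi * (-(c * Real.log η) + D * (1 - η)) := by
    rw [integral_fun_norm_addHaar]
    simp_rw [hfy]
    have hvol : volume.real (Metric.ball (0 : Plane) 1) = Real.pi := by
      rw [Measure.real, EuclideanSpace.volume_ball_fin_two]
      simp [Real.pi_pos.le]
    rw [setIntegral_indicator measurableSet_Ico, Set.inter_eq_right.2 hsub,
      integral_Ico_eq_integral_Ioc, ← intervalIntegral.integral_of_le hη1.le,
      intervalIntegral.integral_add
        ((intervalIntegral.intervalIntegrable_inv hne continuousOn_id).const_mul c)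
        intervalIntegrable_const, intervalIntegral.integral_const_mul,
      integral_inv (fun h => hne 0 h rfl), hvol]
    simp [Real.log_inv]
    ring
  calc _ ≤ ∫⁻ x, ENNReal.ofReal (f ‖x - p‖) := by
        rw [← lintegral_indicator (measurableSet_ball.diff measurableSet_ball)]
        refine lintegral_mono fun x => ?_
        by_cases hx : x ∈ Metric.ball p 1 \ Metric.ball p η
        · have hx' : ‖x - p‖ ∈ Set.Ico η 1 := by
            rw [Set.mem_sdiff, mem_ball_iff_norm, mem_ball_iff_norm, not_lt] at hx
            exact ⟨hx.2, hx.1⟩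
          rw [Set.indicator_of_mem hx, hf, Set.indicator_of_mem hx']
        · rw [Set.indicator_of_notMem hx]; exact zero_le
    _ = ∫⁻ x : Plane, ENNReal.ofReal (f ‖x‖) :=
        lintegral_sub_right_eq_self (fun x => ENNReal.ofReal (f ‖x‖)) p
    _ = ENNReal.ofReal (∫ x : Plane, f ‖x‖) :=
        (ofReal_integral_eq_lintegral_ofReal hint (.of_forall fun x => hf0 _)).symm
    _ ≤ _ := by
        rw [hval]
        refine ENNReal.ofReal_le_ofReal ?_
        have := Real.pi_pos
        gcongr
        nlinarith

/-- The logarithm must carry the weight `χ p`, not `χ x`. Replacing one by the other costs `G r ·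
r⁻² = G / r`, and the cross term of the square costs `2 B (1 + G) / r`; together they form `D`,
harmless in dimension two. The bounded part `B²` goes into the bulk term. Points up to distance `R +
1` can influence `B_R`. -/
theorem lintegral_energy_le {Λ : Set Plane} {j : Plane → Plane} {χ : Plane → ℝ} {R G B : ℝ}
    {F : Finset Plane} (hG : 0 ≤ G) (hB : 0 ≤ B) (hF : ∀ p ∈ Λ, ‖p‖ < R + 1 → p ∈ F)
    (hχ0 : ∀ x, 0 ≤ χ x) (hχR : ∀ x ∉ Metric.ball (0 : Plane) R, χ x = 0)
    (hlip : ∀ x y, χ x ≤ χ y + G * ‖x - y‖) (hχ1 : ∀ x, χ x ≤ 1 + G)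
    (hj : ∀ x, ‖j x‖ ≤ B ∨ ∃ p ∈ Λ, ‖x - p‖ < 1 ∧ ‖j x‖ ≤ ‖x - p‖⁻¹ + B)
    {η : ℝ} (hη : 0 < η) (hη1 : η < 1) :
    ∫⁻ x in (⋃ p ∈ Λ, Metric.ball p η)ᶜ, ENNReal.ofReal (χ x * ‖j x‖ ^ 2)
      ≤ ENNReal.ofReal ((1 + G) * B ^ 2) * volume (Metric.ball (0 : Plane) R)
        + ∑ p ∈ F, ENNReal.ofReal
          (2 * Real.pi * (-(χ p * Real.log η) + (G + 2 * B * (1 + G)))) := by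
  set D : ℝ := G + 2 * B * (1 + G)
  have hD : 0 ≤ D := by positivity
  set U : Set Plane := (⋃ p ∈ Λ, Metric.ball p η)ᶜ with hU
  set v : Plane → Plane → ℝ≥0∞ := fun p =>
    (Metric.ball p 1 \ Metric.ball p η).indicator fun x =>
      ENNReal.ofReal (χ p * (‖x - p‖⁻¹) ^ 2 + D * ‖x - p‖⁻¹) with hv
  set u : Plane → ℝ≥0∞ := (Metric.ball (0 : Plane) R).indicator fun _ =>
    ENNReal.ofReal ((1 + G) * B ^ 2) with hu
  have hUm : MeasurableSet U := (isOpen_biUnion fun p _ => Metric.isOpen_ball).measurableSet.compl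
  have hvm : ∀ p, Measurable (v p) := fun p => by
    refine Measurable.indicator ?_ (measurableSet_ball.diff measurableSet_ball)
    fun_prop
  have hum : Measurable u := measurable_const.indicator measurableSet_ball
  have hpt : ∀ x ∈ U, ENNReal.ofReal (χ x * ‖j x‖ ^ 2) ≤ u x + ∑ p ∈ F, v p x := by
    intro x hx
    by_cases hxR : x ∈ Metric.ball (0 : Plane) R
    swap
    · rw [hχR x hxR]; simp
    rw [hu, Set.indicator_of_mem hxR]
    rcases hj x with h | ⟨p, hp, hxp, h⟩
    · refine le_add_right (ENNReal.ofReal_le_ofReal ?_)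
      have := hχ1 x
      have := hχ0 x
      gcongr
    · have hpF : p ∈ F := hF p hp <| by
        have h1 := norm_sub_rev x p ▸ norm_le_norm_add_norm_sub' p x
        linarith [mem_ball_zero_iff.1 hxR]
      refine le_trans ?_ (add_le_add_right (Finset.single_le_sum (f := fun p => v p x)
        (fun _ _ => zero_le) hpF) _)
      have hxm : x ∈ Metric.ball p 1 \ Metric.ball p η :=
        ⟨mem_ball_iff_norm.2 hxp, fun h' => hx (Set.mem_iUnion₂.2 ⟨p, hp, h'⟩)⟩
      rw [hv]
      simp only
      rw [Set.indicator_of_mem hxm, ← ENNReal.ofReal_add (by positivity) (by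
        have := hχ0 p; positivity)]
      refine ENNReal.ofReal_le_ofReal ?_
      have hr : 0 < ‖x - p‖ := by
        have := hxm.2
        rw [mem_ball_iff_norm, not_lt] at this
        linarith
      set r := ‖x - p‖
      have h1 : χ x * ‖j x‖ ^ 2 ≤ χ x * (r⁻¹ + B) ^ 2 := by
        have := hχ0 x
        gcongr
      have h2 : χ x * (r⁻¹) ^ 2 ≤ (χ p + G * r) * (r⁻¹) ^ 2 := by
        have := hlip x p
        gcongr
      have h3 : (χ p + G * r) * (r⁻¹) ^ 2 = χ p * (r⁻¹) ^ 2 + G * r⁻¹ := by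
        field_simp
      have h4 : χ x * (2 * B * r⁻¹ + B ^ 2) ≤ (1 + G) * (2 * B * r⁻¹ + B ^ 2) := by
        have := hχ1 x
        gcongr
      calc _ ≤ χ x * (r⁻¹) ^ 2 + χ x * (2 * B * r⁻¹ + B ^ 2) := by linarith
        _ ≤ χ p * (r⁻¹) ^ 2 + G * r⁻¹ + (1 + G) * (2 * B * r⁻¹ + B ^ 2) := by linarith
        _ = _ := by simp only [D]; ring
  calc _ ≤ ∫⁻ x in U, (u x + ∑ p ∈ F, v p x) := setLIntegral_mono' hUm hpt
    _ ≤ ∫⁻ x, (u x + ∑ p ∈ F, v p x) := setLIntegral_le_lintegral _ _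
    _ = (∫⁻ x, u x) + ∑ p ∈ F, ∫⁻ x, v p x := by
        rw [lintegral_add_left hum, lintegral_finsetSum _ fun p _ => hvm p]
    _ ≤ _ := by
        refine add_le_add (le_of_eq ?_) (Finset.sum_le_sum fun p _ => ?_)
        · rw [hu, lintegral_indicator_const measurableSet_ball]
        · rw [hv]
          simp only
          rw [lintegral_indicator (measurableSet_ball.diff measurableSet_ball)]
          exact lintegral_annulus_le p hη hη1 (hχ0 p) hD

theorem volume_ball_plane {R : ℝ} (hR : 0 ≤ R) :
    volume (Metric.ball (0 : Plane) R) = ENNReal.ofReal (Real.pi * R ^ 2) := by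
  rw [EuclideanSpace.volume_ball_fin_two, ← ENNReal.ofReal_pow hR, ← NNReal.coe_real_pi,
    mul_comm NNReal.pi.toReal, ENNReal.ofReal_mul (by positivity), ENNReal.ofReal_coe_nnreal]

theorem localEnergy_le {Λ : Set Plane} {j : Plane → Plane} {χ : Plane → ℝ} {R G B : ℝ}
    {F : Finset Plane} (hR : 0 ≤ R) (hG : 0 ≤ G) (hB : 0 ≤ B)
    (hF : ∀ p ∈ Λ, ‖p‖ < R + 1 → p ∈ F) (hFΛ : ∀ p ∈ F, p ∈ Λ) (hχ0 : ∀ x, 0 ≤ χ x)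
    (hχR : ∀ x ∉ Metric.ball (0 : Plane) R, χ x = 0)
    (hlip : ∀ x y, χ x ≤ χ y + G * ‖x - y‖) (hχ1 : ∀ x, χ x ≤ 1 + G)
    (hj : ∀ x, ‖j x‖ ≤ B ∨ ∃ p ∈ Λ, ‖x - p‖ < 1 ∧ ‖j x‖ ≤ ‖x - p‖⁻¹ + B) :
    localEnergy Λ j χ ≤ ((2⁻¹ * ((1 + G) * B ^ 2 * (Real.pi * R ^ 2))
      + Real.pi * (G + 2 * B * (1 + G)) * F.card : ℝ) : EReal) := by
  refine limsup_le_of_le (by isBoundedDefault) ?_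
  filter_upwards [Ioo_mem_nhdsGT (zero_lt_one (α := ℝ))] with η hη
  set D : ℝ := G + 2 * B * (1 + G)
  have hD : 0 ≤ D := by positivity
  have hlog : Real.log η ≤ 0 := Real.log_nonpos hη.1.le hη.2.le
  have hterm : ∀ p, 0 ≤ 2 * Real.pi * (-(χ p * Real.log η) + D) := fun p => by
    have := hχ0 p
    have := Real.pi_pos
    have h : 0 ≤ -(χ p * Real.log η) := by nlinarith
    positivity
  have h := lintegral_energy_le hG hB hF hχ0 hχR hlip hχ1 hj hη.1 hη.2
  rw [volume_ball_plane hR, ← ENNReal.ofReal_mul (by positivity),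
    ← ENNReal.ofReal_sum_of_nonneg fun p _ => hterm p,
    ← ENNReal.ofReal_add (by positivity) (Finset.sum_nonneg fun p _ => hterm p)] at h
  set T : ℝ := (1 + G) * B ^ 2 * (Real.pi * R ^ 2)
    + ∑ p ∈ F, 2 * Real.pi * (-(χ p * Real.log η) + D) with hT
  have hT0 : 0 ≤ T := add_nonneg (by positivity) (Finset.sum_nonneg fun p _ => hterm p)
  have hsum : ∑ᶠ p ∈ Λ, χ p = ∑ p ∈ F, χ p := by
    refine finsum_mem_eq_sum_of_subset _ ?_ hFΛ
    rintro p ⟨hp, hps⟩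
    refine hF p hp ?_
    by_contra hlt
    refine hps (hχR p fun hp' => hlt ?_)
    linarith [mem_ball_zero_iff.1 hp']
  have h2 : 2⁻¹ * ∫⁻ x in (⋃ p ∈ Λ, Metric.ball p η)ᶜ, ENNReal.ofReal (χ x * ‖j x‖ ^ 2)
      ≤ ENNReal.ofReal (2⁻¹ * T) := by
    rw [ENNReal.ofReal_mul (by norm_num)]
    refine mul_le_mul' (le_of_eq ?_) h
    rw [ENNReal.ofReal_inv_of_pos (by norm_num)]; simp
  have h3 : ((2⁻¹ * ∫⁻ x in (⋃ p ∈ Λ, Metric.ball p η)ᶜ,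
      ENNReal.ofReal (χ x * ‖j x‖ ^ 2) : ℝ≥0∞) : EReal) ≤ ((2⁻¹ * T : ℝ) : EReal) := by
    refine (EReal.coe_ennreal_le_coe_ennreal_iff.2 h2).trans (le_of_eq ?_)
    rw [EReal.coe_ennreal_ofReal, max_eq_left (by positivity)]
  refine (add_le_add_left h3 _).trans ?_
  rw [← EReal.coe_add, EReal.coe_le_coe_iff, hsum, hT, Finset.mul_sum]
  refine le_of_eq ?_
  -- Half of this sum contains `-π log η ∑ χ p`, the exact opposite of the renormalization term, so
  -- the bound no longer depends on `η`.
  have e : ∑ p ∈ F, 2 * Real.pi * (-(χ p * Real.log η) + D)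
      = -(2 * (∑ p ∈ F, Real.pi * Real.log η * χ p)) + 2 * Real.pi * D * F.card := by
    rw [Finset.mul_sum, ← Finset.sum_neg_distrib, mul_comm (2 * Real.pi * D), ← nsmul_eq_mul,
      ← Finset.sum_const, ← Finset.sum_add_distrib]
    exact Finset.sum_congr rfl fun p _ => by ring
  rw [e]
  ring

theorem card_window_le {Λ : Set Plane} (hΛ : IsUniform Λ) {C : ℝ} (hC : 0 ≤ C)
    (hcount : ∀ (x : Plane) (R : ℝ), 1 < R →
      |((Λ ∩ square x R).ncard : ℝ) - R ^ 2| ≤ C * R) {R : ℝ} (hR : 2 ≤ R) {F : Finset Plane}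
    (hF : ∀ p ∈ F, p ∈ Λ ∧ ‖p‖ < R + 1) : (F.card : ℝ) ≤ (9 + 3 * C) * R ^ 2 := by
  have hb : Bornology.IsBounded (square 0 (2 * R + 2)) := by
    refine (Metric.isBounded_closedBall (x := (0 : Plane)) (r := 2 * R + 2)).subset fun y hy => ?_
    obtain ⟨h1, h2⟩ := hy
    simp only [PiLp.zero_apply, sub_zero] at h1 h2
    rw [mem_closedBall_zero_iff]
    linarith [norm_le_abs_add_abs y]
  have h1 : F.card ≤ (Λ ∩ square 0 (2 * R + 2)).ncard := by
    rw [← Set.ncard_coe_finset]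
    refine Set.ncard_le_ncard (fun p hp => ⟨(hF p hp).1, ?_⟩) (hΛ.finite_inter hb)
    have hn := (hF p hp).2
    have h2 := PiLp.norm_apply_le p 0
    have h3 := PiLp.norm_apply_le p 1
    rw [Real.norm_eq_abs] at h2 h3
    constructor <;> simp only [PiLp.zero_apply, sub_zero] <;> linarith
  have h2 := (abs_le.1 (hcount 0 (2 * R + 2) (by linarith))).2
  have h3 : (F.card : ℝ) ≤ ((Λ ∩ square 0 (2 * R + 2)).ncard : ℝ) := by exact_mod_cast h1
  -- For `R ≥ 2` one has `2R + 2 ≤ 3R ≤ 3R²`, whence the constants `9` and `3 C`.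
  nlinarith [mul_nonneg hC (by nlinarith : 0 ≤ 3 * R ^ 2 - (2 * R + 2))]

end RenormalizedEnergy

end

open RenormalizedEnergy

theorem theorem3 (Λ₁ : Set ℝ) (Λ : Set RenormalizedEnergy.Plane)
    (hΛ : Λ = RenormalizedEnergy.prodInt Λ₁)
    (hunif : RenormalizedEnergy.IsUniform Λ)
    (C : ℝ) (hC : 0 < C)
    (hcount : ∀ (x : RenormalizedEnergy.Plane) (R : ℝ), 1 < R →
      |((Λ ∩ RenormalizedEnergy.square x R).ncard : ℝ) - R ^ 2| ≤ C * R)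
    (χ : ℝ → RenormalizedEnergy.Plane → ℝ) (hχ : RenormalizedEnergy.IsCutoffFamily χ) :
    RenormalizedEnergy.tildeW χ 1 Λ < ⊤ := by
  subst hΛ
  obtain ⟨δ, hδ, hsep⟩ := hunif
  obtain ⟨G, hG, hGχ⟩ := hχ.exists_bound
  have hfin : ∀ a b, (Λ₁ ∩ Set.Icc a b).Finite := fun a b => by
    refine finite_of_separated_of_isBounded hδ (fun p hp q hq hne => ?_)
      ((Metric.isBounded_Icc a b).subset Set.inter_subset_right)
    have h := hsep !₂[p, 0] ⟨by simpa using hp.1, 0, by simp⟩ !₂[q, 0]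
      ⟨by simpa using hq.1, 0, by simp⟩ fun h => hne (by
        simpa using congrFun (congrArg WithLp.ofLp h) 0)
    have e : dist (!₂[p, 0] : Plane) !₂[q, 0] = dist p q := by
      rw [EuclideanSpace.dist_eq]
      simp [Real.dist_eq, Real.sqrt_sq_eq_abs]
    rwa [e] at h
  have hH : ∀ x, |flow Λ₁ x| ≤ 2 * Real.pi * (C + 3) := fun x => by
    have := abs_counting_sub_le hfin hcount hC.le x
    rw [flow, abs_mul, abs_neg, abs_of_pos Real.two_pi_pos]
    gcongr
  -- The bound by `δ / 2` makes the boxes disjoint; the bound by `1 / 2` keeps each box inside the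
  -- unit disc around its center.
  set ρ : ℝ := min δ 1 / 2
  have hρ : 0 < ρ := by positivity
  have hρ' : ρ ≤ 1 / 2 := by
    have := min_le_right δ 1
    simp only [ρ]; linarith
  have hρδ : 2 * ρ ≤ δ := by
    have := min_le_left δ 1
    simp only [ρ]; linarith
  set B : ℝ := 4 + 2 / ρ + 2 * Real.pi * (C + 3)
  have hB : 0 ≤ B := by positivity
  set D : ℝ := G + 2 * B * (1 + G)
  have hD : 0 ≤ D := by positivity
  -- Energy per unit area: the bulk contribution plus `π D` per point, with at most `(9 + 3 C) R²`
  -- points for an area `π R²`.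
  set E : ℝ := 2⁻¹ * ((1 + G) * B ^ 2) + D * (9 + 3 * C)
  refine lt_of_le_of_lt (iInf₂_le (field Λ₁ ρ) (field_mem_fields hfin hρ hρ' hH))
    (lt_of_le_of_lt ?_ (EReal.coe_lt_top E))
  refine limsup_le_of_le (by isBoundedDefault) ?_
  filter_upwards [eventually_ge_atTop (2 : ℝ)] with R hR
  have hR1 : 1 < R := by linarith
  have hFfin : (prodInt Λ₁ ∩ Metric.ball 0 (R + 1)).Finite :=
    IsUniform.finite_inter ⟨δ, hδ, hsep⟩ Metric.isBounded_ball
  have hFmem : ∀ p, p ∈ hFfin.toFinset ↔ p ∈ prodInt Λ₁ ∧ ‖p‖ < R + 1 := fun p => by simp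
  have hle := localEnergy_le (F := hFfin.toFinset) (by linarith : 0 ≤ R) hG hB
    (fun p hp hn => (hFmem p).2 ⟨hp, hn⟩) (fun p hp => ((hFmem p).1 hp).1) (hχ.nonneg R hR1)
    (hχ.eq_zero R hR1) (hGχ R hR).1 (hGχ R hR).2 (norm_field_cases hρ hρ' hρδ hsep hH)
  have hcard := card_window_le ⟨δ, hδ, hsep⟩ hC.le hcount hR fun p hp => (hFmem p).1 hp
  have hvol : volume.real (Metric.ball (0 : Plane) R) = Real.pi * R ^ 2 := by
    rw [Measure.real, volume_ball_plane (by linarith), ENNReal.toReal_ofReal (by positivity)]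
  rw [hvol]
  have hpos : 0 < Real.pi * R ^ 2 := by positivity
  refine (EReal.div_le_div_right_of_nonneg (EReal.coe_nonneg.2 hpos.le) hle).trans ?_
  rw [← EReal.coe_div, EReal.coe_le_coe_iff, div_le_iff₀ hpos]
  have hmul : Real.pi * D * hFfin.toFinset.card ≤ Real.pi * D * ((9 + 3 * C) * R ^ 2) := by
    gcongr
  calc _ ≤ 2⁻¹ * ((1 + G) * B ^ 2 * (Real.pi * R ^ 2))
        + Real.pi * D * ((9 + 3 * C) * R ^ 2) := by gcongr
    _ = _ := by simp only [E]; ring
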